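/- Let $n\in\{1,2,\dots\}\cup\{\infty\}$ and let $\mathcal{TO}_n$ be the Toeplitz--Cuntz algebra, i.e. the unital $C^*$-algebra that is universal for families $(v_i)$ of $n$ isometries with mutually orthogonal ranges (countably many if $n=\infty$, so that $\mathcal{TO}_\infty$ is the Cuntz algebra $\mathcal O_\infty$). Let $\mathcal W$ be the set of finite words (multi-indices) $\mu=(i_1,\dots,i_k)$, $k\ge 0$, in the indices of the generators; put $|\mu|=k$, $v_\mu=v_{i_1}\cdots v_{i_k}$ and $v_\emptyset=1$. For $k\ge 0$ let $\mathcal E_k\subseteq\mathcal{TO}_n$ be the closed linear span of $\{v_\mu:|\mu|=k\}$, a Hilbert space under the inner product (linear in the first variable) given by $g^*f=\langle f,g\rangle 1$, with orthonormal basis $\{v_\mu:|\mu|=k\}$; let $F_{\mathcal E}=\bigoplus_{k\ge0}\mathcal E_k$ be the full Fock space, and let $r(v_m)$ be right multiplication by $v_m$, an isometry $\mathcal E_k\to\mathcal E_{k+1}$ for each $k$. An operator matrix on $F_{\mathcal E}$ is a family $\Omega=(\Omega_{ij})_{i,j\ge0}$ of bounded operators $\Omega_{ij}:\mathcal E_j\to\mathcal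 E_i$; for $x\in\mathcal E_j$, $y\in\mathcal E_i$ write $\langle\Omega x,y\rangle=\langle\Omega_{ij}x,y\rangle$. Let $T_k$ be the bounded operator on $F_{\mathcal E}$ with matrix entries $\Omega_{ij}$ for $0\le i,j\le k$ and zero otherwise. $\Omega$ is positive if every $T_k$ is positive, and locally trace-class if every $T_k$ is trace-class. The slice of a locally trace-class $\Omega$ is the operator matrix with entries $$(\operatorname{slice}\Omega)_{ij}=\sum_{m} r(v_m)^*\,\Omega_{i+1,j+1}\,r(v_m)\qquad(\text{convergent in operator norm}),$$ and $\operatorname{slice}\Omega\le\Omega$ means that $\Omega-\operatorname{slice}\Omega$ is positive. Let $\mathcal C$ be the set of positive locally trace-class operator matrices $\Omega$ with $\operatorname{slice}\Omega\le\Omega$, ordered by: $\Omega_1\preceq\Omega_2$ iff $\Omega_2-\Omega_1\in\mathcal C$. **Theorem.** For every $\Omega\in\mathcal C$ there is a unique positive linear functional $\rho$ on $\mathcal{TO}_n$ such that $$\rho(v_\mu v_\nu^*)=\langle\Omega v_\mu,v_\nu\rangle\qquad(\mu,\nu\in\mathcal W).$$ Moreover, the map $\Omega\mapsto\rho$ is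 an affine order isomorphism of $\mathcal C$ onto the positive part of the dual of $\mathcal{TO}_n$: it is a bijection; for $\Omega_1,\Omega_2\in\mathcal C$ with images $\rho_1,\rho_2$ and reals $a,b\ge0$ the matrix $a\Omega_1+b\Omega_2$ lies in $\mathcal C$ and has image $a\rho_1+b\rho_2$; and $\Omega_1\preceq\Omega_2$ if and only if $\rho_2-\rho_1$ is positive. -/

import Mathlib

open scoped ENNReal ComplexOrder InnerProductSpace

noncomputable section

universe u

namespace ToeplitzCuntz



/-- Transport of a C⋆-algebra structure along a bijection. -/
@[reducible] def transferCStarAlgebra {X : Type*} {S : Type*} [CStarAlgebra S] (e : X ≃ S) :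
    CStarAlgebra X :=
  letI : NormedRing X := e.normedRing
  letI : Algebra ℂ X := e.algebra ℂ
  letI : NormedAlgebra ℂ X := NormedAlgebra.induced ℂ X S (e.algEquiv ℂ)
  letI : StarRing X := e.starRing
  { toNormedRing := inferInstance
    toStarRing := inferInstance
    toNormedAlgebra := inferInstance
    toCompleteSpace := by
      have hi : Isometry e := fun _ _ => rfl
      have h2 := (completeSpace_congr (e := e) hi.isUniformEmbedding)
      exact h2.2 inferInstance
    norm_mul_self_le := fun x => by
      have h := CStarRing.norm_mul_self_le (e x)
      have h1 : ‖star x * x‖ = ‖star (e x) * e x‖ := by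
        change ‖e (e.symm (e (e.symm (star (e x))) * e x))‖ = _
        simp
      rw [h1]
      exact h
    star_smul := fun c x => by
      change e.symm (star (e (e.symm (c • e x)))) = e.symm (star c • e (e.symm (star (e x))))
      simp }

/-- A family of isometries with mutually orthogonal ranges in a unital C⋆-algebra. -/
def IsToeplitzFamily {ι : Type*} {B : Type*} [CStarAlgebra B] (w : ι → B) : Prop :=
  (∀ i, star (w i) * w i = 1) ∧ ∀ i j, i ≠ j → star (w i) * w j = 0

/-- A C⋆-algebra with a family of isometries with mutually orthogonal ranges. The carrier is taken
among sets of subsets of `ℕ` only so that all models form a type; since a C⋆-algebra generated by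
countably many elements has at most continuum many elements, no representation of a countable family
is lost (`exists_model`, `existsUnique_lift`). -/
structure Model (ι : Type) where
  carrier : Set (Set ℕ)
  [cstar : CStarAlgebra carrier]
  [nontriv : Nontrivial carrier]
  gen : ι → carrier
  isToeplitz : IsToeplitzFamily gen

attribute [instance] Model.cstar Model.nontriv

theorem exists_injective_closure_adjoin {B : Type u} [CStarAlgebra B] {s : Set B}
    (hs : s.Countable) :
    ∃ f : (StarAlgebra.adjoin ℂ s).topologicalClosure → Set ℕ, Function.Injective f := by
  have h1 : TopologicalSpace.IsSeparable
      ((StarAlgebra.adjoin ℂ s : StarSubalgebra ℂ B) : Set B) := by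
    have h := StarAlgebra.adjoin_eq_span (R := ℂ) s
    have h' : ((StarAlgebra.adjoin ℂ s : StarSubalgebra ℂ B) : Set B) =
        (Submodule.span ℂ (Submonoid.closure (s ∪ star s) : Set B) : Set B) := by
      rw [← h]; rfl
    rw [h']
    apply TopologicalSpace.IsSeparable.span
    apply Set.Countable.isSeparable
    have h2 : (s ∪ star s).Countable := by
      refine hs.union ?_
      rw [← Set.image_star]
      exact hs.image _
    have : Countable (s ∪ star s : Set B) := h2
    rw [Submonoid.closure_eq_mrange, MonoidHom.coe_mrange]
    have : Countable (FreeMonoid (s ∪ star s : Set B)) :=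
      inferInstanceAs (Countable (List (s ∪ star s : Set B)))
    exact Set.countable_range _
  have h2 : TopologicalSpace.IsSeparable
      ((StarAlgebra.adjoin ℂ s).topologicalClosure : Set B) := h1.closure
  have h3 : SecondCountableTopology (StarAlgebra.adjoin ℂ s).topologicalClosure :=
    h2.secondCountableTopology
  have hc := TopologicalSpace.countable_countableBasis (StarAlgebra.adjoin ℂ s).topologicalClosure
  obtain ⟨g, hg⟩ := hc.exists_injective_nat
  refine ⟨fun x => g '' {u | x ∈ u.1}, fun x y hxy => ?_⟩
  have hxy' := hg.image_injective hxy
  by_contra hne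
  obtain ⟨u, hu, hxu, huy⟩ := (TopologicalSpace.isBasis_countableBasis
    (StarAlgebra.adjoin ℂ s).topologicalClosure).mem_nhds_iff.1
      (isOpen_compl_singleton.mem_nhds (show x ∈ ({y}ᶜ : Set _) from hne))
  have : (⟨u, hu⟩ : TopologicalSpace.countableBasis _) ∈
      {u : TopologicalSpace.countableBasis (StarAlgebra.adjoin ℂ s).topologicalClosure | y ∈ u.1} := by
    rw [← hxy']; exact hxu
  exact huy this rfl

theorem exists_model {ι : Type} [Countable ι] {B : Type u} [CStarAlgebra B] [Nontrivial B]
    {w : ι → B} (hw : IsToeplitzFamily w) :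
    ∃ (M : Model ι) (φ : M.carrier →⋆ₐ[ℂ] B), ∀ i, φ (M.gen i) = w i := by
  let S := (StarAlgebra.adjoin ℂ (Set.range w)).topologicalClosure
  obtain ⟨f, hf⟩ := exists_injective_closure_adjoin (Set.countable_range w)
  have : IsClosed (S : Set B) := StarSubalgebra.isClosed_topologicalClosure _
  have hmem : ∀ i, w i ∈ S := fun i =>
    StarSubalgebra.le_topologicalClosure _ (StarAlgebra.subset_adjoin ℂ _ ⟨i, rfl⟩)
  let e : Set.range f ≃ S := (Equiv.ofInjective f hf).symm
  let _ : CStarAlgebra (Set.range f) := transferCStarAlgebra e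
  let ψ : Set.range f →⋆ₐ[ℂ] S :=
    { toFun := e
      map_one' := e.apply_symm_apply _
      map_mul' := fun _ _ => e.apply_symm_apply _
      map_zero' := e.apply_symm_apply _
      map_add' := fun _ _ => e.apply_symm_apply _
      commutes' := fun _ => e.apply_symm_apply _
      map_star' := fun _ => e.apply_symm_apply _ }
  have hinj : Function.Injective ψ := e.injective
  have : Nontrivial (Set.range f) := e.nontrivial
  have hψ : ∀ i, ψ (e.symm ⟨w i, hmem i⟩) = ⟨w i, hmem i⟩ := fun i => e.apply_symm_apply _
  refine ⟨⟨Set.range f, fun i => e.symm ⟨w i, hmem i⟩, fun i => hinj ?_, fun i j hij => hinj ?_⟩,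
    S.subtype.comp ψ, fun i => ?_⟩
  · rw [map_mul, map_star, map_one, hψ]
    exact Subtype.ext (hw.1 i)
  · rw [map_mul, map_star, map_zero, hψ, hψ]
    exact Subtype.ext (hw.2 i j hij)
  · exact congrArg Subtype.val (hψ i)

variable (ι : Type)

/-- The bounded families of elements of all the models, with the supremum norm. -/
abbrev ModelProduct : Type := lp (fun M : Model ι => M.carrier) ∞

instance : CStarAlgebra (ModelProduct ι) where

theorem norm_gen_le {ι : Type*} {B : Type*} [CStarAlgebra B] [Nontrivial B] {w : ι → B}
    (hw : IsToeplitzFamily w) (i : ι) : ‖w i‖ ≤ 1 := by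
  have h := CStarRing.norm_star_mul_self (x := w i)
  rw [hw.1 i, norm_one] at h
  nlinarith [norm_nonneg (w i)]

/-- The isometry whose component in each model is the given one. -/
def productGen (i : ι) : ModelProduct ι :=
  ⟨fun M => M.gen i, memℓp_infty ⟨1, by
    rintro _ ⟨M, rfl⟩
    exact norm_gen_le M.isToeplitz i⟩⟩

instance isClosed_subalgebra : IsClosed
    ((StarAlgebra.adjoin ℂ (Set.range (productGen ι))).topologicalClosure : Set (ModelProduct ι)) :=
  StarSubalgebra.isClosed_topologicalClosure _

end ToeplitzCuntz

/-- The Toeplitz-Cuntz algebra: the unital C⋆-algebra that is universal for families, indexed by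
`ι`, of isometries with mutually orthogonal ranges (see `ToeplitzCuntz.existsUnique_lift`). -/
def ToeplitzCuntz (ι : Type) : Type :=
  (StarAlgebra.adjoin ℂ (Set.range (ToeplitzCuntz.productGen ι))).topologicalClosure

namespace ToeplitzCuntz
instance (ι : Type) : CStarAlgebra (ToeplitzCuntz ι) :=
  inferInstanceAs (CStarAlgebra
    (StarAlgebra.adjoin ℂ (Set.range (productGen ι))).topologicalClosure)

variable {ι : Type}

/-- The distinguished generating isometries `v_i`. -/
def gen (i : ι) : ToeplitzCuntz ι :=
  ⟨productGen ι i, StarSubalgebra.le_topologicalClosure _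
    (StarAlgebra.subset_adjoin ℂ _ ⟨i, rfl⟩)⟩

theorem isToeplitzFamily_gen : IsToeplitzFamily (gen : ι → ToeplitzCuntz ι) := by
  constructor
  · intro i
    refine Subtype.ext (lp.ext (funext fun M => M.isToeplitz.1 i))
  · intro i j hij
    refine Subtype.ext (lp.ext (funext fun M => M.isToeplitz.2 i j hij))

/-- The inclusion into the product of all models. -/
def inclusion : ToeplitzCuntz ι →⋆ₐ[ℂ] ModelProduct ι :=
  (StarAlgebra.adjoin ℂ (Set.range (productGen ι))).topologicalClosure.subtype

theorem topologicalClosure_adjoin_gen :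
    (StarAlgebra.adjoin ℂ (Set.range (gen : ι → ToeplitzCuntz ι))).topologicalClosure = ⊤ := by
  have hemb : Topology.IsEmbedding (inclusion : ToeplitzCuntz ι → ModelProduct ι) :=
    Topology.IsEmbedding.subtypeVal
  refine eq_top_iff.2 fun x _ => ?_
  have hx : inclusion x ∈ closure
      ((StarAlgebra.adjoin ℂ (Set.range (productGen ι)) : StarSubalgebra ℂ (ModelProduct ι)) :
        Set (ModelProduct ι)) := x.2
  have h1 : (StarAlgebra.adjoin ℂ (Set.range (gen : ι → ToeplitzCuntz ι))).map inclusion =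
      StarAlgebra.adjoin ℂ (Set.range (productGen ι)) := by
    rw [StarAlgHom.map_adjoin, ← Set.range_comp]
    rfl
  rw [← h1, StarSubalgebra.coe_map] at hx
  change x ∈ closure _
  rw [hemb.closure_eq_preimage_closure_image]
  exact hx

/-- The component at a model. -/
def evalModel (M : Model ι) : ToeplitzCuntz ι →⋆ₐ[ℂ] M.carrier :=
  { toFun := fun x => inclusion x M
    map_one' := rfl
    map_mul' := fun _ _ => rfl
    map_zero' := rfl
    map_add' := fun _ _ => rfl
    commutes' := fun _ => rfl
    map_star' := fun _ => rfl }

/-- The universal property, for C⋆-algebras in every universe. -/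
theorem existsUnique_lift [Countable ι] {B : Type u} [CStarAlgebra B] {w : ι → B}
    (hw : IsToeplitzFamily w) :
    ∃! φ : ToeplitzCuntz ι →⋆ₐ[ℂ] B, ∀ i, φ (gen i) = w i := by
  refine existsUnique_of_exists_of_unique ?_ ?_
  · rcases subsingleton_or_nontrivial B with hB | hB
    · exact ⟨{ toFun := fun _ => 0
               map_one' := Subsingleton.elim _ _
               map_mul' := fun _ _ => Subsingleton.elim _ _
               map_zero' := rfl
               map_add' := fun _ _ => Subsingleton.elim _ _
               commutes' := fun _ => Subsingleton.elim _ _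
               map_star' := fun _ => Subsingleton.elim _ _ }, fun _ => Subsingleton.elim _ _⟩
    · obtain ⟨M, φ, hφ⟩ := exists_model hw
      exact ⟨φ.comp (evalModel M), hφ⟩
  · intro φ ψ hφ hψ
    have hc : ∀ θ : ToeplitzCuntz ι →⋆ₐ[ℂ] B, Continuous θ := fun θ =>
      AddMonoidHomClass.continuous_of_bound θ 1 fun x => by
        simpa using NonUnitalStarAlgHom.norm_apply_le θ x
    have hle : StarAlgebra.adjoin ℂ (Set.range (gen : ι → ToeplitzCuntz ι)) ≤
        StarAlgHom.equalizer φ ψ := by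
      apply StarAlgebra.adjoin_le
      rintro _ ⟨i, rfl⟩
      exact (hφ i).trans (hψ i).symm
    have hcl : IsClosed (StarAlgHom.equalizer φ ψ : Set (ToeplitzCuntz ι)) :=
      isClosed_eq (hc φ) (hc ψ)
    have := StarSubalgebra.topologicalClosure_minimal hle hcl
    rw [topologicalClosure_adjoin_gen] at this
    exact StarAlgHom.ext fun x => this trivial


theorem exists_isToeplitzFamily (ι : Type) :
    ∃ V : ι → (lp (fun _ : List ι => ℂ) 2 →L[ℂ] lp (fun _ : List ι => ℂ) 2),
      IsToeplitzFamily V := by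
  let b : HilbertBasis (List ι) ℂ (lp (fun _ : List ι => ℂ) 2) :=
    HilbertBasis.ofRepr (LinearIsometryEquiv.refl ℂ _)
  have ho : ∀ i : ι, Orthonormal ℂ (fun μ : List ι => b (i :: μ)) := fun i =>
    b.orthonormal.comp (fun μ : List ι => i :: μ) (List.cons_injective)
  let U : ι → (lp (fun _ : List ι => ℂ) 2 →ₗᵢ[ℂ] lp (fun _ : List ι => ℂ) 2) := fun i =>
    (ho i).orthogonalFamily.linearIsometry
  have hU : ∀ i x, HasSum (fun μ : List ι => x μ • b (i :: μ)) (U i x) := fun i x =>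
    (ho i).orthogonalFamily.hasSum_linearIsometry x
  refine ⟨fun i => (U i).toContinuousLinearMap, fun i => ?_, fun i j hij => ?_⟩
  · exact ((U i).toContinuousLinearMap.norm_map_iff_adjoint_comp_self).1 (U i).norm_map
  · refine ContinuousLinearMap.ext fun x => ext_inner_left ℂ fun y => ?_
    change inner ℂ y ((ContinuousLinearMap.adjoint (U i).toContinuousLinearMap)
      ((U j).toContinuousLinearMap x)) = inner ℂ y 0
    rw [ContinuousLinearMap.adjoint_inner_right, inner_zero_right]
    have h1 : ∀ μ : List ι, inner ℂ (b (i :: μ)) (U j x) = 0 := fun μ => by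
      have h := (hU j x).mapL (innerSL ℂ (b (i :: μ)))
      refine h.unique ?_
      convert hasSum_zero with ν
      have : i :: μ ≠ j :: ν := fun h => hij (List.cons.inj h).1
      simp [b.orthonormal.inner_eq_zero this]
    have h2 := (hU i y).mapL (innerSL ℂ (U j x))
    have h3 : inner ℂ (U j x) (U i y) = 0 := by
      refine h2.unique ?_
      convert hasSum_zero with ν
      simp [inner_eq_zero_symm.1 (h1 ν)]
    exact inner_eq_zero_symm.1 h3

instance [Countable ι] : Nontrivial (ToeplitzCuntz ι) := by
  obtain ⟨V, hV⟩ := exists_isToeplitzFamily ι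
  obtain ⟨φ, -, -⟩ := existsUnique_lift hV
  classical
  have : Nontrivial (lp (fun _ : List ι => ℂ) 2) :=
    ⟨⟨lp.single 2 [] 1, 0, fun h => by
      have := congrArg (fun f : lp (fun _ : List ι => ℂ) 2 => f []) h
      simp at this⟩⟩
  refine ⟨⟨0, 1, fun h => ?_⟩⟩
  have h' := congrArg φ h
  rw [map_zero, map_one] at h'
  exact zero_ne_one h'

/-- The product of generators `v_μ = v_{i₁} ⋯ v_{iₖ}` for the multi-index `μ = (i₁, …, iₖ)`. -/
def word (μ : List ι) : ToeplitzCuntz ι := (μ.map gen).prod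

variable (ι) in
/-- The closed linear span `E_k` of the `v_μ` with `|μ| = k`. -/
def wordSpan (k : ℕ) : Submodule ℂ (ToeplitzCuntz ι) :=
  (Submodule.span ℂ {x | ∃ μ : List ι, μ.length = k ∧ x = word μ}).topologicalClosure

variable (ι) in
/-- `E_k` as a Hilbert space; its norm is the one of the C⋆-algebra. -/
abbrev WordSpace (k : ℕ) : Type := wordSpan ι k

theorem word_mem (μ : List ι) : word μ ∈ wordSpan ι μ.length :=
  Submodule.le_topologicalClosure _ (Submodule.subset_span ⟨μ, rfl, rfl⟩)

theorem star_word_mul_word {μ ν : List ι} (h : μ.length = ν.length) :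
    ∃ c : ℂ, star (word μ) * word ν = c • (1 : ToeplitzCuntz ι) := by
  classical
  induction μ generalizing ν with
  | nil =>
    obtain rfl : ν = [] := List.eq_nil_of_length_eq_zero h.symm
    exact ⟨1, by simp [word]⟩
  | cons i μ ih =>
    obtain _ | ⟨j, ν⟩ := ν
    · simp at h
    · obtain ⟨c, hc⟩ := ih (ν := ν) (by simpa using h)
      have h0 : star (word (i :: μ)) * word (j :: ν) =
          star (word μ) * (star (gen i) * gen j) * word ν := by
        simp [word, mul_assoc]
      rw [h0]
      by_cases hij : i = j
      · subst hij
        exact ⟨c, by rw [isToeplitzFamily_gen.1 i, mul_one, hc]⟩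
      · exact ⟨0, by rw [isToeplitzFamily_gen.2 i j hij]; simp⟩

/-- For `f, g ∈ E_k` the element `f* g` is a scalar multiple of the identity. -/
theorem exists_star_mul_eq_smul_one [Countable ι] {k : ℕ} (f g : WordSpace ι k) :
    ∃ c : ℂ, star (f : ToeplitzCuntz ι) * g = c • (1 : ToeplitzCuntz ι) := by
  let L : Submodule ℂ (ToeplitzCuntz ι) := Submodule.span ℂ {1}
  have hL : IsClosed (L : Set (ToeplitzCuntz ι)) := L.closed_of_finiteDimensional
  have key : ∀ f ∈ wordSpan ι k, ∀ g ∈ wordSpan ι k, star f * g ∈ L := by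
    have hgen : ∀ g ∈ wordSpan ι k, ∀ μ : List ι, μ.length = k → star (word μ) * g ∈ L := by
      intro g hg μ hμ
      let N : Submodule ℂ (ToeplitzCuntz ι) := L.comap (LinearMap.mulLeft ℂ (star (word μ)))
      have hN : IsClosed (N : Set (ToeplitzCuntz ι)) :=
        hL.preimage (continuous_const.mul continuous_id)
      refine (Submodule.topologicalClosure_minimal _ ?_ hN : wordSpan ι k ≤ N) hg
      rw [Submodule.span_le]
      rintro _ ⟨ν, hν, rfl⟩
      obtain ⟨c, hc⟩ := star_word_mul_word (hμ.trans hν.symm)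
      exact Submodule.mem_span_singleton.2 ⟨c, hc.symm⟩
    intro f hf g hg
    have hstar : ∀ x ∈ L, star x ∈ L := by
      intro x hx
      obtain ⟨c, rfl⟩ := Submodule.mem_span_singleton.1 hx
      exact Submodule.mem_span_singleton.2 ⟨star c, by simp⟩
    have h : star g * f ∈ L := by
      let N : Submodule ℂ (ToeplitzCuntz ι) := L.comap (LinearMap.mulLeft ℂ (star g))
      have hN : IsClosed (N : Set (ToeplitzCuntz ι)) :=
        hL.preimage (continuous_const.mul continuous_id)
      refine (Submodule.topologicalClosure_minimal _ ?_ hN : wordSpan ι k ≤ N) hf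
      rw [Submodule.span_le]
      rintro _ ⟨ν, hν, rfl⟩
      have := hstar _ (hgen g hg ν hν)
      rw [star_mul, star_star] at this
      exact this
    simpa using hstar _ h
  obtain ⟨c, hc⟩ := Submodule.mem_span_singleton.1 (key f f.2 g g.2)
  exact ⟨c, hc.symm⟩

section Hilbert

variable [Countable ι]

/-- The inner product on `E_k`, determined by `f* g = ⟪f, g⟫ 1` (conjugate-linear in `f`). -/
instance (k : ℕ) : Inner ℂ (WordSpace ι k) where
  inner f g := (exists_star_mul_eq_smul_one f g).choose

theorem star_mul_eq_inner {k : ℕ} (f g : WordSpace ι k) :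
    star (f : ToeplitzCuntz ι) * g = inner ℂ f g • (1 : ToeplitzCuntz ι) :=
  (exists_star_mul_eq_smul_one f g).choose_spec

theorem inner_eq_of_star_mul {k : ℕ} {f g : WordSpace ι k} {c : ℂ}
    (h : star (f : ToeplitzCuntz ι) * g = c • (1 : ToeplitzCuntz ι)) : inner ℂ f g = c :=
  smul_left_injective ℂ (one_ne_zero (α := ToeplitzCuntz ι)) ((star_mul_eq_inner f g).symm.trans h)

instance (k : ℕ) : InnerProductSpace ℂ (WordSpace ι k) where
  norm_sq_eq_re_inner x := by
    have h := star_mul_eq_inner x x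
    have h1 : ‖(x : ToeplitzCuntz ι)‖ ^ 2 = ‖inner ℂ x x‖ := by
      rw [sq, ← CStarRing.norm_star_mul_self, h, norm_smul, norm_one, mul_one]
    have h2 : (0 : ℂ) ≤ inner ℂ x x := by
      let _ := CStarAlgebra.spectralOrder (ToeplitzCuntz ι)
      have := CStarAlgebra.spectralOrderedRing (ToeplitzCuntz ι)
      have h3 : (0 : ToeplitzCuntz ι) ≤ star (x : ToeplitzCuntz ι) * x := star_mul_self_nonneg _
      refine spectrum_nonneg_of_nonneg h3 ?_
      rw [h, ← Algebra.algebraMap_eq_smul_one, spectrum.scalar_eq]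
      rfl
    change ‖(x : ToeplitzCuntz ι)‖ ^ 2 = _
    rw [h1]
    exact Complex.norm_of_nonneg' h2 |> fun h => by
      have := congrArg Complex.re h
      simpa using this
  conj_inner_symm x y := by
    refine (inner_eq_of_star_mul ?_).symm
    have := congrArg star (star_mul_eq_inner y x)
    simpa using this
  add_left x y z := inner_eq_of_star_mul (by
    simp [add_mul, add_smul, star_mul_eq_inner])
  smul_left x y r := inner_eq_of_star_mul (by
    simp [star_mul_eq_inner, smul_smul])

instance (k : ℕ) : CompleteSpace (WordSpace ι k) :=
  (Submodule.isClosed_topologicalClosure _).completeSpace_coe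


variable (ι) in
/-- The full Fock space `F_E = ⨁ₖ E_k`. -/
abbrev FockSpace : Type := lp (fun k : ℕ => WordSpace ι k) 2

/-- Right multiplication by `v_m`, as a map `r(v_m) : E_k → E_{k+1}`. -/
def rightCreation (k : ℕ) (m : ι) : WordSpace ι k →L[ℂ] WordSpace ι (k + 1) :=
  (((ContinuousLinearMap.mul ℂ (ToeplitzCuntz ι)).flip (gen m)).comp
    (wordSpan ι k).subtypeL).codRestrict (wordSpan ι (k + 1)) (by
      let N : Submodule ℂ (ToeplitzCuntz ι) :=
        (wordSpan ι (k + 1)).comap (LinearMap.mulRight ℂ (gen m))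
      have hN : IsClosed (N : Set (ToeplitzCuntz ι)) :=
        (Submodule.isClosed_topologicalClosure _).preimage (continuous_id.mul continuous_const)
      intro x
      refine (Submodule.topologicalClosure_minimal _ ?_ hN : wordSpan ι k ≤ N) x.2
      rw [Submodule.span_le]
      rintro _ ⟨μ, hμ, rfl⟩
      refine Submodule.le_topologicalClosure _ (Submodule.subset_span ⟨μ ++ [m], ?_, ?_⟩)
      · simp [hμ]
      · simp [word])

theorem rightCreation_apply (k : ℕ) (m : ι) (x : WordSpace ι k) :
    (rightCreation k m x : ToeplitzCuntz ι) = x * gen m := rfl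

/-- The vector `v_μ`, seen in `E_{|μ|}`. -/
def wordVec (μ : List ι) : WordSpace ι μ.length := ⟨word μ, word_mem μ⟩

variable (ι) in
/-- Infinite operator matrices `Ω = (Ω_{ij})` with `Ω_{ij} : E_j → E_i` bounded. -/
abbrev OperatorMatrix : Type := ∀ i j : ℕ, WordSpace ι j →L[ℂ] WordSpace ι i

namespace OperatorMatrix

/-- The operator `T_k` on Fock space with matrix `(Ω_{ij})_{0 ≤ i, j ≤ k}` and zeros elsewhere. -/
def truncation (Ω : OperatorMatrix ι) (k : ℕ) : FockSpace ι →L[ℂ] FockSpace ι :=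
  ∑ i ∈ Finset.range (k + 1), ∑ j ∈ Finset.range (k + 1),
    (lp.singleContinuousLinearMap ℂ (fun k : ℕ => WordSpace ι k) 2 i).comp
      ((Ω i j).comp (lp.evalCLM ℂ (fun k : ℕ => WordSpace ι k) 2 j))

/-- `Ω` is positive if every `T_k` is positive. -/
def IsPositive (Ω : OperatorMatrix ι) : Prop := ∀ k, (truncation Ω k).IsPositive

end OperatorMatrix
end Hilbert

section TraceClass

/-- `T` is trace-class: `∑ ⟪|T| e_i, e_i⟫ < ∞` for every orthonormal basis `(e_i)`. -/
def IsTraceClass {H : Type u} [NormedAddCommGroup H] [InnerProductSpace ℂ H] [CompleteSpace H]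
    (T : H →L[ℂ] H) : Prop :=
  ∀ (κ : Type u) (b : HilbertBasis κ ℂ H),
    Summable fun i => (inner ℂ (b i) (CFC.abs T (b i))).re

end TraceClass

variable [Countable ι]

namespace OperatorMatrix

/-- `Ω` is locally trace-class if every `T_k` is trace-class. -/
def IsLocallyTraceClass (Ω : OperatorMatrix ι) : Prop := ∀ k, IsTraceClass (truncation Ω k)

/-- `(slice Ω)_{ij} = ∑_m r(v_m)* Ω_{i+1,j+1} r(v_m)`, summed in operator norm (for infinitely many
generators the sum converges if `Ω` is locally trace-class). -/
def slice (Ω : OperatorMatrix ι) : OperatorMatrix ι := fun i j =>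
  ∑' m : ι, (ContinuousLinearMap.adjoint (rightCreation i m)).comp
    ((Ω (i + 1) (j + 1)).comp (rightCreation j m))

end OperatorMatrix

variable (ι) in
/-- The positive locally trace-class operator matrices `Ω` with `slice Ω ≤ Ω`. -/
def sliceDecreasingCone : Set (OperatorMatrix ι) :=
  {Ω | Ω.IsPositive ∧ Ω.IsLocallyTraceClass ∧ (Ω - Ω.slice).IsPositive}

/-- A functional is positive if `0 ≤ ρ(a* a)` for all `a` (in particular `ρ(a* a)` is real). -/
def IsPositiveFunctional (ρ : ToeplitzCuntz ι → ℂ) : Prop := ∀ a, 0 ≤ ρ (star a * a)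

variable (ι) in
/-- The positive part of the dual space. -/
def positiveDual : Set (StrongDual ℂ (ToeplitzCuntz ι)) := {ρ | IsPositiveFunctional ρ}

/-- The relation `ρ(v_μ v_ν*) = ⟨Ω v_μ, v_ν⟩` for all multi-indices `μ, ν`, where `⟨·, ·⟩` is linear
in its first argument, that is `⟨x, y⟩ = inner ℂ y x`. -/
def HasDensityMatrix (ρ : ToeplitzCuntz ι → ℂ) (Ω : OperatorMatrix ι) : Prop :=
  ∀ μ ν : List ι,
    ρ (word μ * star (word ν)) = inner ℂ (wordVec ν) (Ω ν.length μ.length (wordVec μ))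

/-- The index set of the generators: `{0, …, n - 1}` for finite `n`, and `ℕ` for `n = ∞`. -/
abbrev Letters (n : ℕ∞) : Type := {i : ℕ // (i : ℕ∞) < n}

end ToeplitzCuntz

end

/-! ### Normal ordering, density, and automatic continuity of positive functionals -/

namespace ToeplitzCuntz

open Filter Topology

variable {ι : Type}

/-! The elements `v_μ v_ν*` span a dense *-subalgebra and positive functionals are automatically
continuous, so ρ is determined by Ω. Conversely Ω is determined by its coefficients K(μ,ν) = ⟨Ω v_μ,
v_ν⟩, because the `v_μ` form an orthonormal basis of Fock space. The problem thus becomes one about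
kernels on words: Ω positive makes K positive definite, locally trace-class means that the diagonal
of K is summable over the words of length at most k for each k, and the slice is L(μ,ν) = Σ_m
K(μm,νm).

From Ω to ρ (`IsPosDefKernel.isRepresentable`). For f in ℓ² of the words, the left creation
operators give a vector functional with kernel Σ_τ conj f(μτ) f(ντ). Every positive definite kernel
D with summable diagonal is a limit of finite sums of rank-one kernels, so Σ_τ D(μτ,ντ) also comes
from a positive functional, by weak-* compactness. If D = K - L, this sum should telescope back to
K, but K has in general no summable diagonal. Replacing K by r^(|μ|+|ν|) K(μ,ν) with r < 1 cures
this: the mass of K on words of length k is at most K(∅,∅), so the rescaled diagonal is dominated by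
a geometric series. Its defect is the rescaling of K - r² L = (1-r²) K + r² (K - L), which is again
positive definite. Letting r tend to 1 gives ρ.

From ρ to Ω (`densityMatrix_mem`). The forms ρ(x y*) define bounded blocks by Riesz representation.
For isometries w_a with orthogonal ranges, 1 - Σ w_a w_a* is a projection, whence Σ ρ(x w_a w_a* x*)
≤ ρ(x x*) (`IsPositiveFunctional.sum_mul_star_le`). Taking for w_a the words of one length gives
local trace-class; taking the generators gives slice Ω ≤ Ω.

The relation between Ω and ρ is linear in the pair, so the affine and order statements follow from
the two uniqueness statements. -/

theorem word_nil : word ([] : List ι) = 1 := rfl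

theorem word_cons (i : ι) (μ : List ι) : word (i :: μ) = gen i * word μ := by simp [word]

theorem word_append (μ ν : List ι) : word (μ ++ ν) = word μ * word ν := by simp [word]

/-- Letters cancel in pairs from the left until one word is exhausted, leaving the tail of the
other, or until two distinct letters meet and the product vanishes. -/
theorem star_word_mul_word_cases (μ ν : List ι) :
    (∃ τ, star (word μ) * word ν = word τ) ∨ (∃ τ, star (word μ) * word ν = star (word τ)) ∨
      star (word μ) * word ν = 0 := by
  classical
  induction μ generalizing ν with
  | nil => exact .inl ⟨ν, by simp [word_nil]⟩
  | cons i μ ih =>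
    obtain _ | ⟨j, ν⟩ := ν
    · exact .inr (.inl ⟨i :: μ, by simp [word_nil]⟩)
    · have h : star (word (i :: μ)) * word (j :: ν) =
          star (word μ) * (star (gen i) * gen j) * word ν := by simp [word_cons, mul_assoc]
      rw [h]
      by_cases hij : i = j
      · subst hij
        rw [isToeplitzFamily_gen.1 i, mul_one]
        exact ih ν
      · exact .inr (.inr (by simp [isToeplitzFamily_gen.2 i j hij]))

variable (ι) in
/-- The linear span of the elements `v_μ v_ν*`. -/
noncomputable def normalOrderedSpan : Submodule ℂ (ToeplitzCuntz ι) :=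
  Submodule.span ℂ (Set.range fun p : List ι × List ι => word p.1 * star (word p.2))

theorem word_mul_star_word_mem (μ ν : List ι) :
    word μ * star (word ν) ∈ normalOrderedSpan ι :=
  Submodule.subset_span ⟨(μ, ν), rfl⟩

theorem mul_mem_normalOrderedSpan {a b : ToeplitzCuntz ι} (ha : a ∈ normalOrderedSpan ι)
    (hb : b ∈ normalOrderedSpan ι) : a * b ∈ normalOrderedSpan ι := by
  have h : normalOrderedSpan ι * normalOrderedSpan ι ≤ normalOrderedSpan ι := by
    rw [normalOrderedSpan, Submodule.span_mul_span, Submodule.span_le]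
    rintro _ ⟨_, ⟨⟨μ, ν⟩, rfl⟩, _, ⟨⟨α, β⟩, rfl⟩, rfl⟩
    have e : word μ * star (word ν) * (word α * star (word β)) =
      word μ * (star (word ν) * word α) * star (word β) := by simp only [mul_assoc]
    change word μ * star (word ν) * (word α * star (word β)) ∈ normalOrderedSpan ι
    rw [e]
    obtain ⟨τ, h⟩ | ⟨τ, h⟩ | h := star_word_mul_word_cases ν α <;> rw [h]
    · rw [← word_append]
      exact word_mul_star_word_mem _ _
    · rw [mul_assoc, ← star_mul, ← word_append]
      exact word_mul_star_word_mem _ _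
    · simp
  exact h (Submodule.mul_mem_mul ha hb)

theorem star_mem_normalOrderedSpan {a : ToeplitzCuntz ι} (ha : a ∈ normalOrderedSpan ι) :
    star a ∈ normalOrderedSpan ι := by
  induction ha using Submodule.span_induction with
  | mem x hx =>
    obtain ⟨⟨μ, ν⟩, rfl⟩ := hx
    simpa using word_mul_star_word_mem ν μ
  | zero => simp
  | add x y _ _ hx hy => rw [star_add]; exact add_mem hx hy
  | smul c x _ hx => rw [star_smul]; exact Submodule.smul_mem _ _ hx

theorem dense_normalOrderedSpan : Dense (normalOrderedSpan ι : Set (ToeplitzCuntz ι)) := by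
  have hle : ((StarAlgebra.adjoin ℂ (Set.range (gen : ι → ToeplitzCuntz ι)) :
      StarSubalgebra ℂ (ToeplitzCuntz ι)) : Set (ToeplitzCuntz ι)) ⊆ normalOrderedSpan ι := by
    have h1 : (1 : ToeplitzCuntz ι) ∈ normalOrderedSpan ι := by
      simpa [word_nil] using word_mul_star_word_mem ([] : List ι) []
    intro x hx
    induction hx using StarAlgebra.adjoin_induction with
    | mem x hx =>
      obtain ⟨i, rfl⟩ := hx
      simpa [word_nil, word_cons] using word_mul_star_word_mem [i] []
    | algebraMap r =>
      rw [Algebra.algebraMap_eq_smul_one]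
      exact Submodule.smul_mem _ _ h1
    | add x y _ _ hx hy => exact add_mem hx hy
    | mul x y _ _ hx hy => exact mul_mem_normalOrderedSpan hx hy
    | star x _ hx => exact star_mem_normalOrderedSpan hx
  intro x
  refine closure_mono hle ?_
  have h : x ∈ (StarAlgebra.adjoin ℂ
      (Set.range (gen : ι → ToeplitzCuntz ι))).topologicalClosure := by
    rw [topologicalClosure_adjoin_gen]; trivial
  exact h

/-- Continuous functionals on the Toeplitz-Cuntz algebra are determined by the elements
`v_μ v_ν*`. -/
theorem strongDual_ext {ρ σ : StrongDual ℂ (ToeplitzCuntz ι)}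
    (h : ∀ μ ν : List ι, ρ (word μ * star (word ν)) = σ (word μ * star (word ν))) : ρ = σ := by
  have hd := dense_normalOrderedSpan (ι := ι)
  refine ContinuousLinearMap.ext_on hd ?_
  rintro _ ⟨⟨μ, ν⟩, rfl⟩
  exact h μ ν

/-- This makes ρ unique among all linear functionals, since a density argument needs continuity. -/
theorem IsPositiveFunctional.continuous {ρ : ToeplitzCuntz ι →ₗ[ℂ] ℂ}
    (hρ : IsPositiveFunctional ρ) : Continuous ρ := by
  let _ := CStarAlgebra.spectralOrder (ToeplitzCuntz ι)
  have := CStarAlgebra.spectralOrderedRing (ToeplitzCuntz ι)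
  have hnn : ∀ x : ToeplitzCuntz ι, 0 ≤ x → 0 ≤ ρ x := fun x hx => by
    obtain ⟨b, rfl⟩ := CStarAlgebra.nonneg_iff_eq_star_mul_self.1 hx
    exact hρ b
  exact (map_continuous (PositiveLinearMap.mk₀ ρ hnn) :)

theorem IsPositiveFunctional.apply_mul_star_nonneg {ρ : ToeplitzCuntz ι → ℂ}
    (hρ : IsPositiveFunctional ρ) (a : ToeplitzCuntz ι) : 0 ≤ ρ (a * star a) := by
  simpa using hρ (star a)

end ToeplitzCuntz

-- The basis of words in Fock space and the matrix coefficients of an operator matrix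

universe u

namespace ToeplitzCuntz

open Filter Topology

variable {ι : Type}

theorem star_word_mul_word_self (μ : List ι) : star (word μ) * word μ = 1 := by
  induction μ with
  | nil => simp [word_nil]
  | cons i μ ih =>
    have h : star (word (i :: μ)) * word (i :: μ) =
      star (word μ) * (star (gen i) * gen i) * word μ := by simp [word_cons, mul_assoc]
    rw [h, isToeplitzFamily_gen.1 i, mul_one, ih]

theorem star_word_mul_word_of_ne {μ ν : List ι} (h : μ.length = ν.length) (hne : μ ≠ ν) :
    star (word μ) * word ν = 0 := by
  classical
  induction μ generalizing ν with
  | nil => exact absurd (List.eq_nil_of_length_eq_zero h.symm).symm hne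
  | cons i μ ih =>
    obtain _ | ⟨j, ν⟩ := ν
    · simp at h
    · have h0 : star (word (i :: μ)) * word (j :: ν) =
          star (word μ) * (star (gen i) * gen j) * word ν := by simp [word_cons, mul_assoc]
      rw [h0]
      by_cases hij : i = j
      · subst hij
        rw [isToeplitzFamily_gen.1 i, mul_one]
        exact ih (by simpa using h) (by simpa using hne)
      · simp [isToeplitzFamily_gen.2 i j hij]

/-- The vector `v_μ` of Fock space. -/
noncomputable def fockVec (μ : List ι) : FockSpace ι :=
  lp.single 2 μ.length (wordVec μ)

theorem fockVec_apply_length (μ : List ι) : fockVec μ μ.length = wordVec μ :=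
  lp.single_apply_self _ _ _

theorem fockVec_apply_of_ne {μ : List ι} {k : ℕ} (h : k ≠ μ.length) : fockVec μ k = 0 :=
  lp.single_apply_ne _ _ _ h

theorem fockVec_eq_single {k : ℕ} {μ : List ι} {x : WordSpace ι k} (h : μ.length = k)
    (hx : (x : ToeplitzCuntz ι) = word μ) : fockVec μ = lp.single 2 k x := by
  subst h
  have : wordVec μ = x := Subtype.ext hx.symm
  rw [fockVec, this]

/-- The elements y with x* y = 0 form a closed subspace that contains the words of length k, hence x
itself; then x* x = 0. -/
theorem wordSpace_eq_zero {k : ℕ} {x : WordSpace ι k}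
    (h : ∀ μ : List ι, μ.length = k → star (word μ) * (x : ToeplitzCuntz ι) = 0) : x = 0 := by
  have h1 : star (x : ToeplitzCuntz ι) * x = 0 := by
    let N : Submodule ℂ (ToeplitzCuntz ι) :=
      LinearMap.ker (LinearMap.mulLeft ℂ (star (x : ToeplitzCuntz ι)))
    have hN : IsClosed (N : Set (ToeplitzCuntz ι)) :=
      isClosed_singleton.preimage (continuous_const.mul continuous_id)
    refine (Submodule.topologicalClosure_minimal _ ?_ hN : wordSpan ι k ≤ N) x.2
    rw [Submodule.span_le]
    rintro _ ⟨μ, hμ, rfl⟩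
    have := congrArg star (h μ hμ)
    simpa [N] using this
  exact Subtype.ext (CStarRing.star_mul_self_eq_zero_iff _ |>.1 h1)

variable [Countable ι]

theorem inner_fockVec_single {k : ℕ} {μ : List ι} (h : μ.length = k) (x : WordSpace ι k) :
    inner ℂ (fockVec μ) (lp.single 2 k x) • (1 : ToeplitzCuntz ι) =
      star (word μ) * (x : ToeplitzCuntz ι) := by
  subst h
  rw [lp.inner_single_right, fockVec_apply_length, ← star_mul_eq_inner]
  rfl

theorem orthonormal_fockVec : Orthonormal ℂ (fockVec : List ι → FockSpace ι) := by
  classical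
  rw [orthonormal_iff_ite]
  intro μ ν
  by_cases h : μ.length = ν.length
  · have h1 := inner_fockVec_single h (wordVec ν)
    have h2 : star (word μ) * (wordVec ν : ToeplitzCuntz ι) =
        (if μ = ν then 1 else 0 : ℂ) • (1 : ToeplitzCuntz ι) := by
      split_ifs with hμν
      · subst hμν
        rw [one_smul]
        exact star_word_mul_word_self μ
      · rw [zero_smul]
        exact star_word_mul_word_of_ne h hμν
    exact smul_left_injective ℂ (one_ne_zero (α := ToeplitzCuntz ι)) (h1.trans h2)
  · rw [if_neg (fun h' => h (by rw [h']))]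
    conv_lhs => rw [fockVec, lp.inner_single_left, fockVec_apply_of_ne h, inner_zero_right]

variable (ι) in
/-- The orthonormal basis of Fock space formed by the vectors `v_μ`. -/
noncomputable def fockBasis : HilbertBasis (List ι) ℂ (FockSpace ι) :=
  HilbertBasis.mkOfOrthogonalEqBot orthonormal_fockVec <| by
    rw [Submodule.eq_bot_iff]
    intro f hf
    rw [Submodule.mem_orthogonal] at hf
    refine lp.ext (funext fun k => wordSpace_eq_zero fun μ hμ => ?_)
    subst hμ
    have h := hf (fockVec μ) (Submodule.subset_span ⟨μ, rfl⟩)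
    rw [fockVec, lp.inner_single_left] at h
    have h2 := star_mul_eq_inner (wordVec μ) (f μ.length)
    rw [h, zero_smul] at h2
    exact h2

theorem fockBasis_apply (μ : List ι) : fockBasis ι μ = fockVec μ := by
  rw [fockBasis, HilbertBasis.coe_mkOfOrthogonalEqBot]

/-- The type of `wordVec μ` depends on `μ.length`. Comparing underlying elements of the algebra with
words avoids transport along equalities of lengths. -/
theorem ext_wordVec {i j : ℕ} {A B : WordSpace ι j →L[ℂ] WordSpace ι i}
    (h : ∀ (x : WordSpace ι j) (y : WordSpace ι i) (μ ν : List ι), μ.length = j → ν.length = i →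
      (x : ToeplitzCuntz ι) = word μ → (y : ToeplitzCuntz ι) = word ν →
        inner ℂ y (A x) = inner ℂ y (B x)) : A = B := by
  have h1 : ∀ (x : WordSpace ι j) (μ : List ι), μ.length = j → (x : ToeplitzCuntz ι) = word μ →
      A x - B x = 0 := by
    intro x μ hμ hx
    refine wordSpace_eq_zero fun ν hν => ?_
    subst hν
    have := star_mul_eq_inner (wordVec ν) (A x - B x)
    rw [inner_sub_right, h x _ μ ν hμ rfl hx rfl, sub_self, zero_smul] at this
    exact this
  let N : Submodule ℂ (WordSpace ι j) := LinearMap.ker (A - B).toLinearMap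
  have hN : IsClosed (N : Set (WordSpace ι j)) := (A - B).isClosed_ker
  have hN' : IsClosed ((N.map (wordSpan ι j).subtype : Submodule ℂ (ToeplitzCuntz ι)) :
      Set (ToeplitzCuntz ι)) := by
    rw [Submodule.map_coe]
    exact (Submodule.isClosed_topologicalClosure _).isClosedEmbedding_subtypeVal.isClosedMap _ hN
  have hle : wordSpan ι j ≤ N.map (wordSpan ι j).subtype := by
    refine Submodule.topologicalClosure_minimal _ ?_ hN'
    rw [Submodule.span_le]
    rintro _ ⟨μ, rfl, rfl⟩
    exact ⟨wordVec μ, h1 _ μ rfl rfl, rfl⟩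
  refine ContinuousLinearMap.ext fun x => ?_
  obtain ⟨y, hy, hyx⟩ := hle x.2
  obtain rfl : y = x := Subtype.ext hyx
  exact sub_eq_zero.1 hy

namespace OperatorMatrix

/-- The matrix coefficients `⟨Ω v_μ, v_ν⟩`. -/
noncomputable def kernel (Ω : OperatorMatrix ι) (μ ν : List ι) : ℂ :=
  inner ℂ (wordVec ν) (Ω ν.length μ.length (wordVec μ))

theorem kernel_eq (Ω : OperatorMatrix ι) {i j : ℕ} {μ ν : List ι} (hμ : μ.length = j)
    (hν : ν.length = i) {x : WordSpace ι j} {y : WordSpace ι i}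
    (hx : (x : ToeplitzCuntz ι) = word μ) (hy : (y : ToeplitzCuntz ι) = word ν) :
    inner ℂ y (Ω i j x) = Ω.kernel μ ν := by
  subst hμ hν
  obtain rfl : x = wordVec μ := Subtype.ext hx
  obtain rfl : y = wordVec ν := Subtype.ext hy
  rfl

theorem ext_kernel {Ω₁ Ω₂ : OperatorMatrix ι} (h : Ω₁.kernel = Ω₂.kernel) : Ω₁ = Ω₂ := by
  funext i j
  refine ext_wordVec fun x y μ ν hμ hν hx hy => ?_
  rw [kernel_eq Ω₁ hμ hν hx hy, kernel_eq Ω₂ hμ hν hx hy, h]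

theorem inner_truncation (Ω : OperatorMatrix ι) (k : ℕ) (f g : FockSpace ι) :
    inner ℂ f (truncation Ω k g) = ∑ i ∈ Finset.range (k + 1), ∑ j ∈ Finset.range (k + 1),
      inner ℂ (f i) (Ω i j (g j)) := by
  simp only [truncation, sum_apply, inner_sum]
  refine Finset.sum_congr rfl fun i _ => Finset.sum_congr rfl fun j _ => ?_
  exact lp.inner_single_right i _ f

theorem inner_truncation_fockVec (Ω : OperatorMatrix ι) {k : ℕ} (μ ν : List ι) :
    inner ℂ (fockVec ν) (truncation Ω k (fockVec μ)) =
      if μ.length ≤ k ∧ ν.length ≤ k then Ω.kernel μ ν else 0 := by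
  rw [inner_truncation]
  have h : ∀ i j, inner ℂ (fockVec ν i) (Ω i j (fockVec μ j)) =
      if ν.length = i ∧ μ.length = j then Ω.kernel μ ν else 0 := by
    intro i j
    by_cases hi : ν.length = i
    · by_cases hj : μ.length = j
      · subst hi hj
        rw [fockVec_apply_length, fockVec_apply_length]
        simp [kernel]
      · simp [hj, fockVec_apply_of_ne (Ne.symm hj)]
    · simp [hi, fockVec_apply_of_ne (Ne.symm hi)]
  simp only [h, ite_and]
  split_ifs <;> simp_all

/-- Over ℂ a quadratic form with real values belongs to a symmetric operator, so self-adjointness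
need not be checked separately. -/
theorem isPositive_iff_inner (Ω : OperatorMatrix ι) :
    Ω.IsPositive ↔ ∀ k (f : FockSpace ι), 0 ≤ inner ℂ f (truncation Ω k f) := by
  refine forall_congr' fun k => ⟨fun h f => h.inner_nonneg_right f, fun h => ?_⟩
  rw [ContinuousLinearMap.isPositive_iff_complex]
  intro f
  have h1 := h f
  have h2 : inner ℂ (truncation Ω k f) f = inner ℂ f (truncation Ω k f) := by
    rw [← inner_conj_symm]
    exact (IsSelfAdjoint.of_nonneg h1).star_eq
  rw [Complex.le_def] at h1
  rw [h2]
  exact ⟨Complex.ext rfl h1.2, h1.1⟩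

/-- The matrix coefficients of a positive operator matrix are a positive definite kernel. -/
theorem IsPositive.sum_kernel_nonneg {Ω : OperatorMatrix ι} (h : Ω.IsPositive)
    (s : Finset (List ι)) (c : List ι → ℂ) :
    0 ≤ ∑ ν ∈ s, ∑ μ ∈ s, star (c ν) * Ω.kernel μ ν * c μ := by
  -- The truncation level is the largest length in `s`, so that no coefficient is cut off.
  have h1 := (isPositive_iff_inner Ω).1 h (s.sup List.length) (∑ μ ∈ s, c μ • fockVec μ)
  refine h1.trans_eq ?_
  rw [sum_inner]
  refine Finset.sum_congr rfl fun ν hν => ?_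
  rw [map_sum, inner_sum]
  refine Finset.sum_congr rfl fun μ hμ => ?_
  rw [map_smul, inner_smul_left, inner_smul_right, inner_truncation_fockVec,
    if_pos ⟨Finset.le_sup (f := List.length) hμ, Finset.le_sup (f := List.length) hν⟩]
  simp only [RCLike.star_def]
  ring

end OperatorMatrix

/-! ### Hilbert-Schmidt sums and trace-class operators -/

theorem hasSum_norm_inner_sq {H κ : Type*} [NormedAddCommGroup H] [InnerProductSpace ℂ H]
     (b : HilbertBasis κ ℂ H) (x : H) :
    HasSum (fun i => ‖inner ℂ (b i) x‖ ^ 2) (‖x‖ ^ 2) := by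
  have h := Complex.hasSum_re (b.hasSum_inner_mul_inner x x)
  rw [← inner_self_eq_norm_sq (𝕜 := ℂ) x]
  refine h.congr_fun fun i => ?_
  rw [← RCLike.re_to_complex, inner_mul_symm_re_eq_norm, norm_mul, norm_inner_symm x, sq]

section TraceClass

variable {H K : Type*} [NormedAddCommGroup H] [InnerProductSpace ℂ H] [CompleteSpace H]
  [NormedAddCommGroup K] [InnerProductSpace ℂ K] [CompleteSpace K]

theorem exists_inner_eq_of_isPositive {T : H →L[ℂ] H} (hT : T.IsPositive) :
    ∃ S : H →L[ℂ] H, ∀ x y, inner ℂ x (T y) = inner ℂ (S x) (S y) := by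
  obtain ⟨S, hS⟩ := CStarAlgebra.nonneg_iff_eq_star_mul_self.1
    ((ContinuousLinearMap.nonneg_iff_isPositive T).2 hT)
  refine ⟨S, fun x y => ?_⟩
  rw [hS, ← ContinuousLinearMap.adjoint_inner_right]
  rfl

/-- By Parseval both sums are the double sum of |⟨b'_j, S b_i⟩|², read in the two orders. -/
theorem summable_norm_sq_adjoint {κ κ' : Type*} (b : HilbertBasis κ ℂ H)
    (b' : HilbertBasis κ' ℂ K) {S : H →L[ℂ] K} (h : Summable fun i => ‖S (b i)‖ ^ 2) :
    Summable fun i => ‖S.adjoint (b' i)‖ ^ 2 := by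
  have h1 : Summable fun p : κ × κ' => ‖inner ℂ (b' p.2) (S (b p.1))‖ ^ 2 := by
    rw [summable_prod_of_nonneg fun p => by positivity]
    refine ⟨fun i => (hasSum_norm_inner_sq b' (S (b i))).summable, h.congr fun i => ?_⟩
    exact (hasSum_norm_inner_sq b' (S (b i))).tsum_eq.symm
  have h2 := ((summable_prod_of_nonneg fun p => by positivity).1 h1.prod_symm).2
  refine h2.congr fun i => ?_
  rw [← (hasSum_norm_inner_sq b (S.adjoint (b' i))).tsum_eq]
  refine tsum_congr fun j => ?_
  rw [ContinuousLinearMap.adjoint_inner_right, norm_inner_symm]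
  rfl

/-- Passing to the adjoint twice, through an auxiliary basis of the target, replaces one basis of
the source by another. -/
theorem summable_norm_sq_of_basis {κ κ' : Type*} (b : HilbertBasis κ ℂ H)
    (b' : HilbertBasis κ' ℂ H) {S : H →L[ℂ] K} (h : Summable fun i => ‖S (b i)‖ ^ 2) :
    Summable fun i => ‖S (b' i)‖ ^ 2 := by
  obtain ⟨w, c, -⟩ := exists_hilbertBasis ℂ K
  simpa using summable_norm_sq_adjoint c b' (summable_norm_sq_adjoint b c h)

/-- The operator norm is at most the Hilbert-Schmidt norm. -/
theorem norm_sq_le_tsum_of_basis {κ : Type*} (b : HilbertBasis κ ℂ H) {S : H →L[ℂ] K}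
    (h : Summable fun i => ‖S (b i)‖ ^ 2) : ‖S‖ ^ 2 ≤ ∑' i, ‖S (b i)‖ ^ 2 := by
  have h0 : 0 ≤ ∑' i, ‖S (b i)‖ ^ 2 := tsum_nonneg fun i => by positivity
  -- The adjoint is estimated instead of S: the coordinates of S* y are ⟨b_i, S* y⟩ = ⟨S b_i, y⟩, to
  -- which Parseval and Cauchy-Schwarz apply.
  rw [← Real.le_sqrt (norm_nonneg _) h0, ← ContinuousLinearMap.adjoint.norm_map S]
  refine ContinuousLinearMap.opNorm_le_bound _ (Real.sqrt_nonneg _) fun y => ?_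
  rw [← Real.sqrt_sq (norm_nonneg y), ← Real.sqrt_mul h0]
  refine Real.le_sqrt_of_sq_le ?_
  rw [← (hasSum_norm_inner_sq b (S.adjoint y)).tsum_eq, ← tsum_mul_right]
  refine (hasSum_norm_inner_sq b (S.adjoint y)).summable.tsum_le_tsum (fun i => ?_)
    (h.mul_right _)
  rw [ContinuousLinearMap.adjoint_inner_right, ← mul_pow]
  gcongr
  exact norm_inner_le_norm _ _

end TraceClass

/-- A positive operator is trace-class as soon as its trace in one basis is finite. -/
theorem isTraceClass_iff_of_isPositive {H : Type u} [NormedAddCommGroup H]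
    [InnerProductSpace ℂ H] [CompleteSpace H] {κ : Type u} (b : HilbertBasis κ ℂ H) {T : H →L[ℂ] H}
    (hT : T.IsPositive) : IsTraceClass T ↔ Summable fun i => (inner ℂ (b i) (T (b i))).re := by
  have habs : CFC.abs T = T := by
    have := (ContinuousLinearMap.nonneg_iff_isPositive T).2 hT
    exact CFC.abs_of_nonneg T this
  simp only [IsTraceClass, habs]
  refine ⟨fun h => h κ b, fun h κ' b' => ?_⟩
  obtain ⟨S, hS⟩ := exists_inner_eq_of_isPositive hT
  have hS' : ∀ x, (inner ℂ x (T x)).re = ‖S x‖ ^ 2 := fun x => by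
    rw [hS, ← inner_self_eq_norm_sq (𝕜 := ℂ)]
    rfl
  simp only [hS'] at h ⊢
  exact summable_norm_sq_of_basis b b' h

namespace OperatorMatrix

theorem isLocallyTraceClass_iff {Ω : OperatorMatrix ι} (h : Ω.IsPositive) :
    Ω.IsLocallyTraceClass ↔
      ∀ k, Summable fun μ : List ι => if μ.length ≤ k then (Ω.kernel μ μ).re else 0 := by
  refine forall_congr' fun k => ?_
  rw [isTraceClass_iff_of_isPositive (fockBasis ι) (h k)]
  simp only [fockBasis_apply, inner_truncation_fockVec, and_self, apply_ite Complex.re,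
    Complex.zero_re]

end OperatorMatrix

end ToeplitzCuntz

/-! ### Positive definite kernels and norm convergence of the slice -/

namespace ToeplitzCuntz

open Filter Topology

variable {ι : Type}

/-- Positive definite kernels on the set of words. -/
structure IsPosDefKernel (K : List ι → List ι → ℂ) : Prop where
  star_apply : ∀ μ ν, star (K μ ν) = K ν μ
  sum_nonneg : ∀ (s : Finset (List ι)) (c : List ι → ℂ),
    0 ≤ ∑ ν ∈ s, ∑ μ ∈ s, star (c ν) * K μ ν * c μ

namespace IsPosDefKernel

variable {K : List ι → List ι → ℂ}

theorem diag_nonneg (hK : IsPosDefKernel K) (μ : List ι) : 0 ≤ K μ μ := by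
  simpa using hK.sum_nonneg {μ} 1

theorem re_diag_nonneg (hK : IsPosDefKernel K) (μ : List ι) : 0 ≤ (K μ μ).re :=
  (Complex.le_def.1 (hK.diag_nonneg μ)).1

theorem ofReal_re_diag (hK : IsPosDefKernel K) (μ : List ι) : (((K μ μ).re : ℝ) : ℂ) = K μ μ :=
  Complex.ext rfl (Complex.le_def.1 (hK.diag_nonneg μ)).2

theorem norm_diag (hK : IsPosDefKernel K) (μ : List ι) : ‖K μ μ‖ = (K μ μ).re := by
  rw [← hK.ofReal_re_diag, Complex.norm_real, Real.norm_of_nonneg (hK.re_diag_nonneg μ),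
    Complex.ofReal_re]

/-- The arithmetic mean, rather than the geometric one, bounds off-diagonal sums directly by sums
along the diagonal. -/
theorem norm_apply_le (hK : IsPosDefKernel K) (μ ν : List ι) :
    ‖K μ ν‖ ≤ ((K μ μ).re + (K ν ν).re) / 2 := by
  classical
  by_cases hμν : μ = ν
  · subst hμν
    rw [hK.norm_diag]
    linarith
  set z := K μ ν with hz
  -- On the vector (|z|, -z) the form equals |z|² (K μ μ + K ν ν - 2|z|).
  have h := hK.sum_nonneg {μ, ν} (fun σ => if σ = μ then (‖z‖ : ℂ) else -z)
  rw [Finset.sum_pair hμν, Finset.sum_pair hμν, Finset.sum_pair hμν, ← hK.star_apply μ ν, ← hz,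
    ← hK.ofReal_re_diag μ, ← hK.ofReal_re_diag ν] at h
  simp only [if_true, if_neg (Ne.symm hμν), RCLike.star_def, map_neg, Complex.conj_ofReal] at h
  have hzz : (starRingEnd ℂ) z * z = ((‖z‖ ^ 2 : ℝ) : ℂ) := by
    rw [mul_comm, Complex.mul_conj, Complex.normSq_eq_norm_sq]
  have e : (‖z‖ : ℂ) * ((K μ μ).re : ℂ) * ‖z‖ + ‖z‖ * (starRingEnd ℂ) z * -z +
      (-(starRingEnd ℂ) z * z * ‖z‖ + -(starRingEnd ℂ) z * ((K ν ν).re : ℂ) * -z) =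
      ((‖z‖ ^ 2 * (((K μ μ).re + (K ν ν).re) - 2 * ‖z‖) : ℝ) : ℂ) := by
    have : (‖z‖ : ℂ) * ((K μ μ).re : ℂ) * ‖z‖ + ‖z‖ * (starRingEnd ℂ) z * -z +
      (-(starRingEnd ℂ) z * z * ‖z‖ + -(starRingEnd ℂ) z * ((K ν ν).re : ℂ) * -z) =
      ‖z‖ ^ 2 * ((K μ μ).re : ℂ) - 2 * ((starRingEnd ℂ) z * z) * ‖z‖ +
        ((starRingEnd ℂ) z * z) * ((K ν ν).re : ℂ) := by ring
    rw [this, hzz]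
    push_cast
    ring
  rw [e, ← Complex.ofReal_zero, Complex.real_le_real] at h
  by_cases hz0 : ‖z‖ = 0
  · rw [hz0]
    linarith [hK.re_diag_nonneg μ, hK.re_diag_nonneg ν]
  · have : 0 < ‖z‖ ^ 2 := by positivity
    linarith [nonneg_of_mul_nonneg_right h this]

end IsPosDefKernel

theorem mul_le_sq_add_sq (a b : ℝ) : a * b ≤ a ^ 2 + b ^ 2 := by
  nlinarith [sq_nonneg (a - b), sq_nonneg (a + b)]

theorem summable_clm_of_norm_le {κ H K : Type*} [NormedAddCommGroup H] [InnerProductSpace ℂ H]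
    [NormedAddCommGroup K] [InnerProductSpace ℂ K] [CompleteSpace K] {A : κ → H →L[ℂ] K} {b : κ → ℝ}
    (hb : Summable b) (h : ∀ m, ‖A m‖ ≤ b m) : Summable A :=
  Summable.of_norm_bounded hb h

theorem norm_le_of_norm_inner_le {H K : Type*} [NormedAddCommGroup H] [InnerProductSpace ℂ H]
    [NormedAddCommGroup K] [InnerProductSpace ℂ K] {A : H →L[ℂ] K} {C : ℝ} (hC : 0 ≤ C)
    (h : ∀ x y, ‖inner ℂ y (A x)‖ ≤ C * ‖x‖ * ‖y‖) : ‖A‖ ≤ C := by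
  refine A.opNorm_le_bound hC fun x => ?_
  have h1 : ‖A x‖ * ‖A x‖ ≤ C * ‖x‖ * ‖A x‖ := by
    rw [← inner_self_eq_norm_mul_norm (𝕜 := ℂ)]
    exact (RCLike.re_le_norm _).trans (h x (A x))
  by_cases h0 : ‖A x‖ = 0
  · rw [h0]
    positivity
  · exact le_of_mul_le_mul_right h1 (lt_of_le_of_ne (norm_nonneg _) (Ne.symm h0))

theorem append_singleton_injective :
    Function.Injective fun p : List ι × ι => p.1 ++ [p.2] := by
  rintro ⟨σ, m⟩ ⟨τ, n⟩ h
  obtain ⟨rfl, h2⟩ := List.append_inj' h rfl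
  simp_all

namespace OperatorMatrix

/-- Right multiplication by `v_m`, restricted to `E_k`, as an operator on Fock space. -/
noncomputable def fockRight (k : ℕ) (m : ι) : FockSpace ι →L[ℂ] FockSpace ι :=
  (lp.singleContinuousLinearMap ℂ (fun k : ℕ => WordSpace ι k) 2 (k + 1)).comp
    ((rightCreation k m).comp (lp.evalCLM ℂ (fun k : ℕ => WordSpace ι k) 2 k))

theorem fockRight_apply (k : ℕ) (m : ι) (f : FockSpace ι) :
    fockRight k m f = lp.single 2 (k + 1) (rightCreation k m (f k)) := rfl

theorem fockRight_single (k : ℕ) (m : ι) (x : WordSpace ι k) :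
    fockRight k m (lp.single 2 k x) = lp.single 2 (k + 1) (rightCreation k m x) := by
  rw [fockRight_apply, lp.single_apply_self]

variable [Countable ι]

theorem IsPositive.isPosDefKernel {Ω : OperatorMatrix ι} (h : Ω.IsPositive) :
    IsPosDefKernel Ω.kernel := by
  refine ⟨fun μ ν => ?_, h.sum_kernel_nonneg⟩
  have h1 := (h (max μ.length ν.length)).inner_left_eq_inner_right (fockVec μ) (fockVec ν)
  rw [← inner_conj_symm, inner_truncation_fockVec, inner_truncation_fockVec,
    if_pos ⟨le_max_left _ _, le_max_right _ _⟩, if_pos ⟨le_max_right _ _, le_max_left _ _⟩] at h1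
  exact h1

theorem sub_kernel (Ω₁ Ω₂ : OperatorMatrix ι) (μ ν : List ι) :
    (Ω₁ - Ω₂).kernel μ ν = Ω₁.kernel μ ν - Ω₂.kernel μ ν := by
  simp [kernel, inner_sub_right]

theorem coe_rightCreation_eq_word {k : ℕ} (m : ι) {x : WordSpace ι k} {μ : List ι}
    (hx : (x : ToeplitzCuntz ι) = word μ) :
    (rightCreation k m x : ToeplitzCuntz ι) = word (μ ++ [m]) := by
  rw [rightCreation_apply, hx, word_append, word_cons, word_nil, mul_one]

theorem fockRight_fockVec (k : ℕ) (m : ι) (μ : List ι) :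
    fockRight k m (fockVec μ) = if μ.length = k then fockVec (μ ++ [m]) else 0 := by
  split_ifs with h
  · subst h
    rw [fockVec, fockRight_single]
    exact (fockVec_eq_single (by simp) (coe_rightCreation_eq_word m rfl)).symm
  · rw [fockRight_apply, fockVec_apply_of_ne (Ne.symm h), map_zero, lp.single_zero]

theorem inner_single_truncation_single (Ω : OperatorMatrix ι) {k i j : ℕ} (hi : i ≤ k) (hj : j ≤ k)
    (x : WordSpace ι j) (y : WordSpace ι i) :
    inner ℂ (lp.single 2 i y : FockSpace ι) (truncation Ω k (lp.single 2 j x)) =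
      inner ℂ y (Ω i j x) := by
  rw [inner_truncation, Finset.sum_eq_single i, Finset.sum_eq_single j, lp.single_apply_self,
    lp.single_apply_self]
  · intro l _ hl
    rw [lp.single_apply_ne _ _ _ hl, map_zero, inner_zero_right]
  · intro h
    exact absurd (Finset.mem_range.2 (Nat.lt_succ_of_le hj)) h
  · intro l _ hl
    refine Finset.sum_eq_zero fun l' _ => ?_
    rw [lp.single_apply_ne _ _ _ hl, inner_zero_left]
  · intro h
    exact absurd (Finset.mem_range.2 (Nat.lt_succ_of_le hi)) h

/-- With T_k = S* S, the form of each slice term is ⟨S r(v_m) y, S r(v_m) x⟩. The product of two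
norms on the right becomes summable over m once both are square summable. -/
theorem norm_le_of_factorization (Ω : OperatorMatrix ι) {k i j : ℕ} (hi : i + 1 ≤ k)
    (hj : j + 1 ≤ k) {S : FockSpace ι →L[ℂ] FockSpace ι}
    (hS : ∀ f g, inner ℂ f (truncation Ω k g) = inner ℂ (S f) (S g)) (m : ι) :
    ‖(ContinuousLinearMap.adjoint (rightCreation i m)).comp
      ((Ω (i + 1) (j + 1)).comp (rightCreation j m))‖ ≤
      ‖S.comp (fockRight i m)‖ * ‖S.comp (fockRight j m)‖ := by
  refine norm_le_of_norm_inner_le (by positivity) fun x y => ?_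
  rw [ContinuousLinearMap.comp_apply, ContinuousLinearMap.adjoint_inner_right,
    ContinuousLinearMap.comp_apply, ← inner_single_truncation_single Ω hi hj, hS,
    ← fockRight_single, ← fockRight_single]
  refine (norm_inner_le_norm _ _).trans ?_
  have hx := (S.comp (fockRight j m)).le_opNorm (lp.single 2 j x)
  have hy := (S.comp (fockRight i m)).le_opNorm (lp.single 2 i y)
  rw [lp.norm_single (by norm_num)] at hx hy
  refine (mul_le_mul hy hx (norm_nonneg _) (by positivity)).trans_eq ?_
  ring

theorem norm_sq_fockVec_of_factorization (Ω : OperatorMatrix ι) {k : ℕ}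
    {S : FockSpace ι →L[ℂ] FockSpace ι}
    (hS : ∀ f g, inner ℂ f (truncation Ω k g) = inner ℂ (S f) (S g)) (σ : List ι) :
    ‖S (fockVec σ)‖ ^ 2 = if σ.length ≤ k then (Ω.kernel σ σ).re else 0 := by
  have h := congrArg Complex.re (hS (fockVec σ) (fockVec σ))
  rw [inner_truncation_fockVec, ← RCLike.re_to_complex, ← RCLike.re_to_complex,
    inner_self_eq_norm_sq (𝕜 := ℂ)] at h
  rw [← h]
  simp only [and_self, apply_ite RCLike.re, RCLike.re_to_complex, Complex.zero_re]

/-- The squared Hilbert-Schmidt norm of S r(v_m) is at most Σ_σ ‖S v_{σm}‖². Since (σ, m) ↦ σm is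
injective, summing over m stays below the sum over all words. -/
theorem summable_norm_sq_comp_fockRight {S : FockSpace ι →L[ℂ] FockSpace ι}
    (hS : Summable fun σ : List ι => ‖S (fockVec σ)‖ ^ 2) (l : ℕ) :
    Summable fun m : ι => ‖S.comp (fockRight l m)‖ ^ 2 := by
  have hsum : Summable fun p : ι × List ι => ‖S (fockVec (p.2 ++ [p.1]))‖ ^ 2 :=
    hS.comp_injective (append_singleton_injective.comp Prod.swap_injective)
  have h1 : Summable fun p : ι × List ι => ‖S.comp (fockRight l p.1) (fockBasis ι p.2)‖ ^ 2 := by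
    refine Summable.of_nonneg_of_le (fun p => by positivity) (fun p => ?_) hsum
    rw [fockBasis_apply, ContinuousLinearMap.comp_apply, fockRight_fockVec]
    split_ifs
    · exact le_rfl
    · rw [map_zero, norm_zero, zero_pow two_ne_zero]
      exact sq_nonneg _
  have h2 := (summable_prod_of_nonneg fun p => by positivity).1 h1
  exact Summable.of_nonneg_of_le (fun _ => by positivity)
    (fun m => norm_sq_le_tsum_of_basis (fockBasis ι) (h2.1 m)) h2.2

/-- The terms of the series that defines the slice are summable in operator norm. -/
theorem summable_slice {Ω : OperatorMatrix ι} (hp : Ω.IsPositive) (ht : Ω.IsLocallyTraceClass)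
    (i j : ℕ) : Summable fun m : ι => (ContinuousLinearMap.adjoint (rightCreation i m)).comp
      ((Ω (i + 1) (j + 1)).comp (rightCreation j m)) := by
  -- A truncation large enough to contain the block (i+1, j+1) and both diagonal blocks that control
  -- it.
  obtain ⟨k, hi, hj⟩ : ∃ k, i + 1 ≤ k ∧ j + 1 ≤ k :=
    ⟨max (i + 1) (j + 1), le_max_left _ _, le_max_right _ _⟩
  obtain ⟨S, hS⟩ := exists_inner_eq_of_isPositive (hp k)
  have hsum : Summable fun σ : List ι => ‖S (fockVec σ)‖ ^ 2 := by
    simp only [norm_sq_fockVec_of_factorization Ω hS]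
    exact (isLocallyTraceClass_iff hp).1 ht _
  have hb := (summable_norm_sq_comp_fockRight hsum i).add (summable_norm_sq_comp_fockRight hsum j)
  have hle : ∀ m : ι, ‖(ContinuousLinearMap.adjoint (rightCreation i m)).comp
      ((Ω (i + 1) (j + 1)).comp (rightCreation j m))‖ ≤
      ‖S.comp (fockRight i m)‖ ^ 2 + ‖S.comp (fockRight j m)‖ ^ 2 := fun m =>
    (norm_le_of_factorization Ω hi hj hS m).trans
      (mul_le_sq_add_sq _ _)
  exact summable_clm_of_norm_le hb hle

theorem hasSum_inner_slice {Ω : OperatorMatrix ι} (hp : Ω.IsPositive)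
    (ht : Ω.IsLocallyTraceClass) {i j : ℕ} (x : WordSpace ι j) (y : WordSpace ι i) :
    HasSum (fun m : ι => inner ℂ (rightCreation i m y)
      (Ω (i + 1) (j + 1) (rightCreation j m x))) (inner ℂ y (Ω.slice i j x)) := by
  have h := (summable_slice hp ht i j).hasSum
  have h2 := h.mapL ((innerSL ℂ y).comp (ContinuousLinearMap.apply ℂ (WordSpace ι i) x))
  refine h2.congr_fun fun m => ?_
  simp [ContinuousLinearMap.adjoint_inner_right]

theorem hasSum_kernel_slice {Ω : OperatorMatrix ι} (hp : Ω.IsPositive)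
    (ht : Ω.IsLocallyTraceClass) (μ ν : List ι) :
    HasSum (fun m : ι => Ω.kernel (μ ++ [m]) (ν ++ [m])) (Ω.slice.kernel μ ν) := by
  refine (hasSum_inner_slice hp ht (wordVec μ) (wordVec ν)).congr_fun fun m => ?_
  exact (kernel_eq Ω (by simp) (by simp) (coe_rightCreation_eq_word m rfl)
    (coe_rightCreation_eq_word m rfl)).symm

end OperatorMatrix

end ToeplitzCuntz

/-! ### Kernels that come from positive functionals -/

namespace ToeplitzCuntz

open Filter Topology

variable {ι : Type}

/-- The left creation operators on `ℓ²` of the words. -/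
theorem exists_isToeplitzFamily_star_apply (ι : Type) :
    ∃ V : ι → (lp (fun _ : List ι => ℂ) 2 →L[ℂ] lp (fun _ : List ι => ℂ) 2),
      IsToeplitzFamily V ∧ ∀ i f σ, (star (V i) f) σ = f (i :: σ) := by
  classical
  let b : HilbertBasis (List ι) ℂ (lp (fun _ : List ι => ℂ) 2) :=
    HilbertBasis.ofRepr (LinearIsometryEquiv.refl ℂ _)
  have hb : ∀ σ, b σ = lp.single 2 σ (1 : ℂ) := fun σ => (b.repr_symm_single σ).symm
  have ho : ∀ i : ι, Orthonormal ℂ (fun μ : List ι => b (i :: μ)) := fun i =>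
    b.orthonormal.comp (fun μ : List ι => i :: μ) (List.cons_injective)
  let U : ι → (lp (fun _ : List ι => ℂ) 2 →ₗᵢ[ℂ] lp (fun _ : List ι => ℂ) 2) := fun i =>
    (ho i).orthogonalFamily.linearIsometry
  have hU : ∀ i σ, U i (b σ) = b (i :: σ) := fun i σ => by
    rw [hb σ]
    exact ((ho i).orthogonalFamily.linearIsometry_apply_single _).trans (by simp)
  have hcoord : ∀ i f σ, (star (U i).toContinuousLinearMap f) σ = f (i :: σ) := fun i f σ => by
    have h := ContinuousLinearMap.adjoint_inner_right (U i).toContinuousLinearMap (b σ) f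
    have h2 : (U i).toContinuousLinearMap (b σ) = b (i :: σ) := hU i σ
    rw [h2, hb, hb, lp.inner_single_left, lp.inner_single_left, RCLike.inner_apply,
      RCLike.inner_apply, map_one, mul_one, mul_one] at h
    exact h
  refine ⟨fun i => (U i).toContinuousLinearMap, ⟨fun i => ?_, fun i j hij => ?_⟩, hcoord⟩
  · exact ((U i).toContinuousLinearMap.norm_map_iff_adjoint_comp_self).1 (U i).norm_map
  · refine ContinuousLinearMap.ext fun x => lp.ext (funext fun σ => ?_)
    refine (hcoord i (U j x) σ).trans ?_
    have h1 : inner ℂ (U j x) (b (i :: σ)) = 0 := by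
      have h := ((ho j).orthogonalFamily.hasSum_linearIsometry x).mapL (innerSL ℂ (b (i :: σ)))
      rw [inner_eq_zero_symm]
      refine h.unique ?_
      convert hasSum_zero with ν
      have : i :: σ ≠ j :: ν := fun h => hij (List.cons.inj h).1
      simp [b.orthonormal.inner_eq_zero this]
    rw [inner_eq_zero_symm, hb, lp.inner_single_left] at h1
    simpa using h1

/-- The kernels `(μ, ν) ↦ ρ(v_μ v_ν*)` of the positive functionals `ρ`. -/
def IsRepresentable (K : List ι → List ι → ℂ) : Prop :=
  ∃ ρ : ToeplitzCuntz ι →ₗ[ℂ] ℂ, IsPositiveFunctional ρ ∧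
    (∀ a, ‖ρ a‖ ≤ (K [] []).re * ‖a‖) ∧ ∀ μ ν, ρ (word μ * star (word ν)) = K μ ν

theorem IsRepresentable.sum {κ : Type*} {K : κ → List ι → List ι → ℂ} (s : Finset κ)
    (h : ∀ k ∈ s, IsRepresentable (K k)) : IsRepresentable fun μ ν => ∑ k ∈ s, K k μ ν := by
  choose! ρ h1 h2 h3 using h
  refine ⟨∑ k ∈ s, ρ k, fun a => ?_, fun a => ?_, fun μ ν => ?_⟩
  · rw [LinearMap.sum_apply]
    exact Finset.sum_nonneg fun k hk => h1 k hk a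
  · rw [LinearMap.sum_apply, Complex.re_sum, Finset.sum_mul]
    exact norm_sum_le_of_le _ fun k hk => h2 k hk a
  · rw [LinearMap.sum_apply]
    exact Finset.sum_congr rfl fun k hk => h3 k hk μ ν

/-- Weak-* compactness by hand: convergence is assumed only on the `v_μ v_ν*`, and an ultrafilter
supplies limits at all other elements. The norm bound in `IsRepresentable` keeps the values
eventually in a compact disc. -/
theorem IsRepresentable.of_tendsto {κ : Type*} {l : Filter κ} [l.NeBot]
    {K : κ → List ι → List ι → ℂ} {K' : List ι → List ι → ℂ} (h : ∀ k, IsRepresentable (K k))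
    (hK : ∀ μ ν, Tendsto (fun k => K k μ ν) l (𝓝 (K' μ ν))) : IsRepresentable K' := by
  choose ρ h1 h2 h3 using h
  set U : Ultrafilter κ := Ultrafilter.of l
  have hU : (U : Filter κ) ≤ l := Ultrafilter.of_le l
  have hre : Tendsto (fun k => (K k [] []).re) U (𝓝 (K' [] []).re) :=
    ((Complex.continuous_re.tendsto _).comp (hK [] [])).mono_left hU
  have hex : ∀ a, ∃ z, Tendsto (fun k => ρ k a) U (𝓝 z) := by
    intro a
    have hev : ∀ᶠ k in (U : Filter κ), ρ k a ∈ Metric.closedBall (0 : ℂ)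
        (((K' [] []).re + 1) * ‖a‖) := by
      filter_upwards [hre.eventually (gt_mem_nhds (lt_add_one _))] with k hk
      rw [mem_closedBall_zero_iff]
      exact (h2 k a).trans (by gcongr)
    obtain ⟨z, -, hz⟩ := (isCompact_closedBall (0 : ℂ) _).ultrafilter_le_nhds
      (U.map fun k => ρ k a) (le_principal_iff.2 hev)
    exact ⟨z, hz⟩
  choose σ hσ using hex
  let σ' : ToeplitzCuntz ι →ₗ[ℂ] ℂ :=
    { toFun := σ
      map_add' := fun a b => tendsto_nhds_unique (hσ (a + b)) <|
        ((hσ a).add (hσ b)).congr fun k => (map_add _ _ _).symm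
      map_smul' := fun c a => tendsto_nhds_unique (hσ (c • a)) <|
        ((hσ a).const_smul c).congr fun k => (map_smul _ _ _).symm }
  have := Complex.orderClosedTopology
  refine ⟨σ', fun a => ?_, fun a => ?_, fun μ ν => ?_⟩
  · exact ge_of_tendsto' (hσ (star a * a)) fun k => h1 k a
  · exact le_of_tendsto_of_tendsto' (hσ a).norm (hre.mul_const _) fun k => h2 k a
  · refine tendsto_nhds_unique (hσ _) (((hK μ ν).mono_left hU).congr fun k => (h3 k μ ν).symm)

variable [Countable ι]

/-- The vector functional of f gives ⟨V_μ* f, V_ν* f⟩, and V_μ* evaluates f at words with the prefix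
μ attached. -/
theorem isRepresentable_of_lp (f : lp (fun _ : List ι => ℂ) 2) :
    ∃ K, IsRepresentable K ∧
      ∀ μ ν, HasSum (fun τ => star (f (μ ++ τ)) * f (ν ++ τ)) (K μ ν) := by
  obtain ⟨V, hV, hVs⟩ := exists_isToeplitzFamily_star_apply ι
  obtain ⟨φ, hφ, -⟩ := existsUnique_lift hV
  have hword : ∀ (μ : List ι) (g : lp (fun _ : List ι => ℂ) 2) τ,
      (star (φ (word μ)) g) τ = g (μ ++ τ) := by
    intro μ
    induction μ with
    | nil => intro g τ; simp [word_nil]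
    | cons i μ ih =>
      intro g τ
      rw [word_cons, map_mul, star_mul, hφ]
      exact (ih _ τ).trans (hVs i g _)
  let ρ : ToeplitzCuntz ι →ₗ[ℂ] ℂ :=
    { toFun := fun a => inner ℂ f (φ a f)
      map_add' := fun a b => by rw [map_add, add_apply, inner_add_right]
      map_smul' := fun c a => by
        rw [map_smul, smul_apply, inner_smul_right]; rfl }
  have hmul : ∀ a b, ρ (star a * b) = inner ℂ (φ a f) (φ b f) := fun a b => by
    change inner ℂ f (φ (star a * b) f) = _
    rw [map_mul, map_star]
    exact ContinuousLinearMap.adjoint_inner_right (φ a) f (φ b f)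
  refine ⟨fun μ ν => ρ (word μ * star (word ν)), ⟨ρ, fun a => ?_, fun a => ?_, fun _ _ => rfl⟩,
    fun μ ν => ?_⟩
  · rw [hmul]
    rw [← inner_self_ofReal_re (𝕜 := ℂ) (φ a f)]
    exact Complex.zero_le_real.2 (inner_self_nonneg (𝕜 := ℂ))
  · have h1 : (ρ (word [] * star (word []))).re = ‖f‖ ^ 2 := by
      have : ρ (word [] * star (word [])) = inner ℂ f f := by
        change inner ℂ f (φ (word [] * star (word [])) f) = _
        simp [word_nil]
      rw [this, ← inner_self_eq_norm_sq (𝕜 := ℂ)]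
      rfl
    rw [h1]
    have h2 : ‖φ a f‖ ≤ ‖a‖ * ‖f‖ := (ContinuousLinearMap.le_opNorm _ _).trans
      (by gcongr; exact NonUnitalStarAlgHom.norm_apply_le φ a)
    calc ‖ρ a‖ ≤ ‖f‖ * ‖φ a f‖ := norm_inner_le_norm (𝕜 := ℂ) f (φ a f)
      _ ≤ ‖f‖ * (‖a‖ * ‖f‖) := by gcongr
      _ = ‖f‖ ^ 2 * ‖a‖ := by ring
  · have h := hmul (star (word μ)) (star (word ν))
    rw [star_star] at h
    rw [map_star, map_star] at h
    change HasSum _ (ρ (word μ * star (word ν)))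
    rw [h]
    refine (lp.hasSum_inner _ _).congr_fun fun τ => ?_
    rw [hword, hword, RCLike.inner_apply]
    exact mul_comm _ _

/-- Restricted to `s`, the kernel is a finite sum of rank-one matrices; each of the vectors,
extended by zero, lies in ℓ² of the words and contributes a vector functional. -/
theorem IsPosDefKernel.isRepresentable_finset {K : List ι → List ι → ℂ}
    [DecidableEq (List ι)] (hK : IsPosDefKernel K) (s : Finset (List ι)) :
    IsRepresentable fun μ ν =>
      ∑' τ, if μ ++ τ ∈ s ∧ ν ++ τ ∈ s then K (μ ++ τ) (ν ++ τ) else 0 := by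
  -- The transpose matches the convention that the first argument of K carries the linear variable.
  let M : Matrix s s ℂ := Matrix.of fun a b => K b a
  have hM : M.PosSemidef := by
    refine Matrix.PosSemidef.of_dotProduct_mulVec_nonneg ?_ fun x => ?_
    · ext a b
      exact hK.star_apply _ _
    · refine (hK.sum_nonneg s fun σ => if h : σ ∈ s then x ⟨σ, h⟩ else 0).trans_eq ?_
      rw [← Finset.sum_coe_sort]
      simp only [dotProduct, Matrix.mulVec, Finset.mul_sum]
      refine Finset.sum_congr rfl fun a _ => ?_
      rw [← Finset.sum_coe_sort]
      refine Finset.sum_congr rfl fun b _ => ?_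
      simp [M, mul_assoc]
  obtain ⟨m, v, hv⟩ := Matrix.posSemidef_iff_eq_sum_vecMulVec.1 hM
  let g : Fin m → List ι → ℂ := fun k σ => if h : σ ∈ s then v k ⟨σ, h⟩ else 0
  have hg : ∀ k, Memℓp (g k) 2 := fun k => by
    refine memℓp_gen (summable_of_ne_finset_zero (s := s) fun σ hσ => ?_)
    simp [g, hσ]
  choose K' h1 h2 using fun k => isRepresentable_of_lp (⟨g k, hg k⟩ : lp (fun _ : List ι => ℂ) 2)
  convert IsRepresentable.sum Finset.univ fun k _ => h1 k using 3 with μ ν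
  refine HasSum.tsum_eq ?_
  refine (hasSum_sum fun k _ => h2 k μ ν).congr_fun fun τ => ?_
  split_ifs with h
  · have h3 := congrFun (congrFun hv ⟨ν ++ τ, h.2⟩) ⟨μ ++ τ, h.1⟩
    have h4 : M ⟨ν ++ τ, h.2⟩ ⟨μ ++ τ, h.1⟩ = K (μ ++ τ) (ν ++ τ) := rfl
    rw [← h4, h3, Matrix.sum_apply]
    refine Finset.sum_congr rfl fun k _ => ?_
    simp [g, h.1, h.2, Matrix.vecMulVec_apply, mul_comm]
  · refine (Finset.sum_eq_zero fun k _ => ?_).symm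
    rcases not_and_or.1 h with h | h <;> simp [g, h]

/-- Limit of the finite cut-offs along finite sets of words; the mean of the two diagonal terms
dominates the series. -/
theorem IsPosDefKernel.isRepresentable_tsum {K : List ι → List ι → ℂ}
    (hK : IsPosDefKernel K) (hs : Summable fun σ => (K σ σ).re) :
    IsRepresentable fun μ ν => ∑' τ, K (μ ++ τ) (ν ++ τ) := by
  classical
  refine IsRepresentable.of_tendsto (l := atTop) hK.isRepresentable_finset fun μ ν => ?_
  have hsum : ∀ μ : List ι, Summable fun τ => (K (μ ++ τ) (μ ++ τ)).re := fun μ =>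
    hs.comp_injective (List.append_right_injective μ)
  refine tendsto_tsum_of_dominated_convergence (((hsum μ).add (hsum ν)).div_const 2)
    (fun τ => ?_) (Eventually.of_forall fun s τ => ?_)
  · refine tendsto_const_nhds.congr' ?_
    filter_upwards [eventually_ge_atTop {μ ++ τ, ν ++ τ}] with s hs
    rw [if_pos ⟨hs (by simp), hs (by simp)⟩]
  · split_ifs
    · exact hK.norm_apply_le _ _
    · rw [norm_zero]
      have := hK.re_diag_nonneg (μ ++ τ)
      have := hK.re_diag_nonneg (ν ++ τ)
      positivity

end ToeplitzCuntz

/-! ### Kernels that dominate their slice: rescaling and telescoping -/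

namespace ToeplitzCuntz

open Filter Topology

variable {ι : Type}

theorem tsum_eq_tsum_append_singleton {α : Type*} [AddCommMonoid α] [TopologicalSpace α]
    {F : List ι → α} (hF : F [] = 0) :
    ∑' σ, F σ = ∑' p : List ι × ι, F (p.1 ++ [p.2]) := by
  refine (append_singleton_injective.tsum_eq fun σ hσ => ?_).symm
  rcases List.eq_nil_or_concat' σ with rfl | ⟨τ, m, rfl⟩
  · exact absurd hF hσ
  · exact ⟨(τ, m), rfl⟩

theorem ennreal_tsum_list (F : List ι → ℝ≥0∞) :
    ∑' σ, F σ = F [] + ∑' (σ : List ι) (m : ι), F (σ ++ [m]) := by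
  rw [ENNReal.tsum_eq_add_tsum_ite [], tsum_eq_tsum_append_singleton (by simp),
    ← ENNReal.tsum_prod (f := fun σ m => F (σ ++ [m]))]
  simp

theorem tsum_list {F : List ι → ℂ} (hF : Summable F) :
    ∑' σ, F σ = F [] + ∑' (σ : List ι) (m : ι), F (σ ++ [m]) := by
  classical
  have h : Summable fun p : List ι × ι => F (p.1 ++ [p.2]) :=
    hF.comp_injective append_singleton_injective
  rw [hF.tsum_eq_add_tsum_ite [], tsum_eq_tsum_append_singleton (by simp), ← h.tsum_prod]
  simp

theorem tsum_pow_length_mul_le {W : List ι → ℝ≥0∞} (hW : ∀ σ, ∑' m, W (σ ++ [m]) ≤ W σ)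
    (q : ℝ≥0∞) : ∑' σ, q ^ σ.length * W σ ≤ (∑' k, q ^ k) * W [] := by
  classical
  -- The total mass on words of length k does not increase with k, so it never exceeds the mass of
  -- the empty word.
  have hk : ∀ k : ℕ, ∑' σ : List ι, (if σ.length = k then W σ else 0) ≤ W [] := by
    intro k
    induction k with
    | zero =>
      refine (tsum_eq_single [] fun σ hσ => ?_).trans_le (by simp)
      rw [if_neg (by simpa using hσ)]
    | succ k ih =>
      rw [ennreal_tsum_list]
      refine le_trans ?_ ih
      rw [if_neg (by simp), zero_add]
      refine ENNReal.tsum_le_tsum fun σ => ?_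
      by_cases h : σ.length = k
      · simpa [h] using hW σ
      · simp [h]
  have h1 : ∀ σ : List ι, q ^ σ.length * W σ =
      ∑' k : ℕ, q ^ k * (if σ.length = k then W σ else 0) := fun σ => by
    rw [tsum_eq_single σ.length fun k hk => by rw [if_neg hk.symm, mul_zero], if_pos rfl]
  simp only [h1]
  rw [ENNReal.tsum_comm, ← ENNReal.tsum_mul_right]
  refine ENNReal.tsum_le_tsum fun k => ?_
  rw [ENNReal.tsum_mul_left]
  gcongr
  exact hk k

theorem summable_pow_length_mul {w : List ι → ℝ} (h0 : ∀ σ, 0 ≤ w σ)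
    (hs : ∀ σ, Summable fun m => w (σ ++ [m])) (hw : ∀ σ, ∑' m, w (σ ++ [m]) ≤ w σ) {q : ℝ}
    (hq0 : 0 ≤ q) (hq1 : q < 1) : Summable fun σ => q ^ σ.length * w σ := by
  have h := tsum_pow_length_mul_le (W := fun σ => ENNReal.ofReal (w σ)) (fun σ => by
    rw [← ENNReal.ofReal_tsum_of_nonneg (fun m => h0 _) (hs σ)]
    exact ENNReal.ofReal_le_ofReal (hw σ)) (ENNReal.ofReal q)
  have hne : ∑' σ : List ι, ENNReal.ofReal (q ^ σ.length * w σ) ≠ ∞ := by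
    refine ne_top_of_le_ne_top (ENNReal.mul_ne_top ?_ ENNReal.ofReal_ne_top)
      (le_trans (le_of_eq (tsum_congr fun σ => ?_)) h)
    · rw [ENNReal.tsum_geometric]
      refine ENNReal.inv_ne_top.2 (tsub_pos_of_lt ?_).ne'
      exact ENNReal.ofReal_lt_one.2 hq1
    · rw [ENNReal.ofReal_mul (by positivity), ENNReal.ofReal_pow hq0]
  refine (ENNReal.summable_toReal hne).congr fun σ => ?_
  exact ENNReal.toReal_ofReal (mul_nonneg (by positivity) (h0 σ))

/-- The kernel `K` rescaled by `r ^ (|μ| + |ν|)`. -/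
noncomputable def scaleKernel (r : ℝ) (K : List ι → List ι → ℂ) (μ ν : List ι) : ℂ :=
  (r : ℂ) ^ μ.length * (r : ℂ) ^ ν.length * K μ ν

theorem scaleKernel_diag (r : ℝ) (K : List ι → List ι → ℂ) (μ : List ι) :
    (scaleKernel r K μ μ).re = (r ^ 2) ^ μ.length * (K μ μ).re := by
  rw [scaleKernel, ← Complex.ofReal_pow, ← Complex.ofReal_mul, Complex.re_ofReal_mul]
  ring

namespace IsPosDefKernel

variable {K L : List ι → List ι → ℂ}

theorem scaleKernel (hK : IsPosDefKernel K) (r : ℝ) : IsPosDefKernel (scaleKernel r K) := by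
  refine ⟨fun μ ν => ?_, fun s c => ?_⟩
  · simp only [ToeplitzCuntz.scaleKernel, star_mul', star_pow, hK.star_apply, RCLike.star_def,
      Complex.conj_ofReal]
    ring
  · refine (hK.sum_nonneg s fun σ => (r : ℂ) ^ σ.length * c σ).trans_eq ?_
    refine Finset.sum_congr rfl fun ν _ => Finset.sum_congr rfl fun μ _ => ?_
    simp only [ToeplitzCuntz.scaleKernel, star_mul', star_pow, RCLike.star_def,
      Complex.conj_ofReal]
    ring

theorem convexCombination (hK : IsPosDefKernel K) (hL : IsPosDefKernel L) {t : ℝ} (h0 : 0 ≤ t)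
    (h1 : t ≤ 1) : IsPosDefKernel fun μ ν => (1 - t : ℂ) * K μ ν + t * L μ ν := by
  refine ⟨fun μ ν => ?_, fun s c => ?_⟩
  · simp [hK.star_apply, hL.star_apply]
  · have h2 : (0 : ℂ) ≤ ((1 - t : ℝ) : ℂ) := Complex.zero_le_real.2 (by linarith)
    have h3 : (0 : ℂ) ≤ (t : ℂ) := Complex.zero_le_real.2 h0
    refine (add_nonneg (mul_nonneg h2 (hK.sum_nonneg s c))
      (mul_nonneg h3 (hL.sum_nonneg s c))).trans_eq ?_
    simp only [Finset.mul_sum, ← Finset.sum_add_distrib]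
    refine Finset.sum_congr rfl fun ν _ => Finset.sum_congr rfl fun μ _ => ?_
    push_cast
    ring

theorem summable_re_scaleKernel_diag (hK : IsPosDefKernel K)
    (hKL : IsPosDefKernel fun μ ν => K μ ν - L μ ν)
    (hL : ∀ μ ν, HasSum (fun m => K (μ ++ [m]) (ν ++ [m])) (L μ ν)) {r : ℝ} (h0 : 0 ≤ r)
    (h1 : r < 1) : Summable fun σ => (ToeplitzCuntz.scaleKernel r K σ σ).re := by
  simp only [scaleKernel_diag]
  refine summable_pow_length_mul hK.re_diag_nonneg
    (fun σ => (Complex.hasSum_re (hL σ σ)).summable) (fun σ => ?_) (sq_nonneg r) (by nlinarith)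
  rw [(Complex.hasSum_re (hL σ σ)).tsum_eq]
  have := hKL.re_diag_nonneg σ
  rw [Complex.sub_re] at this
  linarith

variable [Countable ι]

/-- The rescaled kernel K_r equals Σ_τ D(μτ,ντ), where D = K_r - slice K_r is positive definite with
summable diagonal. -/
theorem isRepresentable_scaleKernel (hK : IsPosDefKernel K)
    (hKL : IsPosDefKernel fun μ ν => K μ ν - L μ ν)
    (hL : ∀ μ ν, HasSum (fun m => K (μ ++ [m]) (ν ++ [m])) (L μ ν)) {r : ℝ} (h0 : 0 ≤ r)
    (h1 : r < 1) : IsRepresentable (ToeplitzCuntz.scaleKernel r K) := by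
  have hsum := hK.summable_re_scaleKernel_diag hKL hL h0 h1
  -- Each of the two appended letters costs a factor r, so the slice of K_r is the rescaling of r²
  -- L. Writing K - r² L as a convex combination of K and K - L shows its positivity.
  set D : List ι → List ι → ℂ :=
    ToeplitzCuntz.scaleKernel r fun μ ν => (1 - (r ^ 2 : ℝ) : ℂ) * K μ ν +
      (r ^ 2 : ℝ) * (K μ ν - L μ ν) with hD
  have hDpos : IsPosDefKernel D :=
    (hK.convexCombination hKL (sq_nonneg r) (by nlinarith)).scaleKernel r
  have hDdiag : Summable fun σ => (D σ σ).re := by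
    refine Summable.of_nonneg_of_le hDpos.re_diag_nonneg (fun σ => ?_) hsum
    rw [hD, scaleKernel_diag, scaleKernel_diag]
    refine mul_le_mul_of_nonneg_left ?_ (by positivity)
    have hLre : 0 ≤ (L σ σ).re := (Complex.hasSum_re (hL σ σ)).nonneg fun m => hK.re_diag_nonneg _
    have : (1 - (r ^ 2 : ℝ) : ℂ) * K σ σ + (r ^ 2 : ℝ) * (K σ σ - L σ σ) =
      K σ σ - ((r ^ 2 : ℝ) : ℂ) * L σ σ := by ring
    rw [this, Complex.sub_re, Complex.re_ofReal_mul]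
    nlinarith [mul_nonneg (sq_nonneg r) hLre]
  convert hDpos.isRepresentable_tsum hDdiag using 3 with μ ν
  set F : List ι → ℂ := fun τ => ToeplitzCuntz.scaleKernel r K (μ ++ τ) (ν ++ τ) with hF
  have hFs : Summable F := by
    have hs : ∀ μ : List ι, Summable fun τ =>
        (ToeplitzCuntz.scaleKernel r K (μ ++ τ) (μ ++ τ)).re := fun μ =>
      hsum.comp_injective (List.append_right_injective μ)
    exact Summable.of_norm_bounded (((hs μ).add (hs ν)).div_const 2)
      fun τ => (hK.scaleKernel r).norm_apply_le _ _
  have hFm : ∀ τ, D (μ ++ τ) (ν ++ τ) = F τ - ∑' m, F (τ ++ [m]) := by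
    intro τ
    have h2 : HasSum (fun m => F (τ ++ [m])) ((r : ℂ) ^ (μ ++ τ).length *
        (r : ℂ) ^ (ν ++ τ).length * r ^ 2 * L (μ ++ τ) (ν ++ τ)) := by
      refine ((hL (μ ++ τ) (ν ++ τ)).mul_left _).congr_fun fun m => ?_
      simp only [hF, ToeplitzCuntz.scaleKernel, ← List.append_assoc]
      rw [List.length_append (as := μ ++ τ), List.length_append (as := ν ++ τ)]
      simp only [List.length_singleton, pow_succ]
      ring
    rw [h2.tsum_eq]
    simp only [hF, hD, ToeplitzCuntz.scaleKernel]
    push_cast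
    ring
  simp only [hFm]
  have hs2 : Summable fun τ => ∑' m, F (τ ++ [m]) := by
    have h : Summable fun p : List ι × ι => F (p.1 ++ [p.2]) :=
      hFs.comp_injective append_singleton_injective
    exact h.prod
  -- Splitting off the last letter turns the subtracted double sum into the sum of F over nonempty
  -- words; only F(∅) = K_r(μ,ν) survives.
  rw [hFs.tsum_sub hs2, tsum_list hFs, add_sub_cancel_right]
  simp [hF]

/-- A positive definite kernel that dominates its slice is represented by a positive functional. -/
theorem isRepresentable (hK : IsPosDefKernel K)
    (hKL : IsPosDefKernel fun μ ν => K μ ν - L μ ν)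
    (hL : ∀ μ ν, HasSum (fun m => K (μ ++ [m]) (ν ++ [m])) (L μ ν)) : IsRepresentable K := by
  refine IsRepresentable.of_tendsto (l := (atTop : Filter ℕ))
    (fun n => hK.isRepresentable_scaleKernel hKL hL (r := n / (n + 1)) (by positivity)
      ((div_lt_one (by positivity)).2 (lt_add_one _))) fun μ ν => ?_
  have hc : Continuous fun r : ℝ => ToeplitzCuntz.scaleKernel r K μ ν := by
    unfold ToeplitzCuntz.scaleKernel
    fun_prop
  have h := (hc.tendsto 1).comp (tendsto_natCast_div_add_atTop (𝕜 := ℝ) 1)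
  simpa [ToeplitzCuntz.scaleKernel, Function.comp_def] using h

end IsPosDefKernel

/-- Every operator matrix in the cone is the density matrix of a positive functional. -/
theorem exists_hasDensityMatrix [Countable ι] {Ω : OperatorMatrix ι}
    (h : Ω ∈ sliceDecreasingCone ι) :
    ∃ ρ : ToeplitzCuntz ι →ₗ[ℂ] ℂ, IsPositiveFunctional ρ ∧ HasDensityMatrix ρ Ω := by
  obtain ⟨hp, ht, hs⟩ := h
  have h1 := hs.isPosDefKernel
  have h2 : (Ω - Ω.slice).kernel = fun μ ν => Ω.kernel μ ν - Ω.slice.kernel μ ν :=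
    funext fun μ => funext fun ν => OperatorMatrix.sub_kernel _ _ _ _
  rw [h2] at h1
  obtain ⟨ρ, hρ, -, hρΩ⟩ := hp.isPosDefKernel.isRepresentable h1
    (OperatorMatrix.hasSum_kernel_slice hp ht)
  exact ⟨ρ, hρ, hρΩ⟩

end ToeplitzCuntz

/-! ### From positive functionals to operator matrices -/

namespace ToeplitzCuntz

open Filter Topology

variable {ι : Type}

/-- A Bessel inequality: with the projection p = Σ w_a w_a*, the difference is ρ(y y*) for y = x (1
- p). -/
theorem IsPositiveFunctional.sum_mul_star_le {ρ : ToeplitzCuntz ι →ₗ[ℂ] ℂ}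
    (hρ : IsPositiveFunctional ρ) {κ : Type*} {w : κ → ToeplitzCuntz ι} {s : Finset κ}
    (h1 : ∀ a ∈ s, star (w a) * w a = 1) (h0 : ∀ a ∈ s, ∀ b ∈ s, a ≠ b → star (w a) * w b = 0)
    (x : ToeplitzCuntz ι) :
    0 ≤ ρ (x * star x) - ∑ a ∈ s, ρ (x * w a * star (x * w a)) := by
  classical
  set p := ∑ a ∈ s, w a * star (w a) with hp
  have hps : star p = p := by simp [hp]
  have hpp : p * p = p := by
    rw [hp, Finset.sum_mul_sum]
    refine Finset.sum_congr rfl fun a ha => ?_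
    rw [Finset.sum_eq_single a]
    · rw [mul_assoc, ← mul_assoc (star (w a)), h1 a ha, one_mul]
    · intro b hb hba
      rw [mul_assoc, ← mul_assoc (star (w a)), h0 a ha b hb hba.symm, zero_mul, mul_zero]
    · exact fun h => absurd ha h
  have h := hρ.apply_mul_star_nonneg (x * (1 - p))
  have e : x * (1 - p) * star (x * (1 - p)) = x * star x - x * p * star x := by
    have : (1 - p) * (1 - p) = 1 - p := by
      rw [mul_sub, sub_mul, sub_mul, hpp]
      simp
    rw [star_mul, star_sub, star_one, hps, mul_assoc, ← mul_assoc (1 - p), this, sub_mul, one_mul,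
      mul_sub, mul_assoc]
  rw [e, map_sub] at h
  convert h using 2
  rw [hp, Finset.mul_sum, Finset.sum_mul, map_sum]
  refine Finset.sum_congr rfl fun a _ => ?_
  rw [star_mul]
  simp only [mul_assoc]

theorem IsPositiveFunctional.lin_comb {ρ₁ ρ₂ : StrongDual ℂ (ToeplitzCuntz ι)}
    (h₁ : IsPositiveFunctional ρ₁) (h₂ : IsPositiveFunctional ρ₂) {a b : ℝ} (ha : 0 ≤ a)
    (hb : 0 ≤ b) : IsPositiveFunctional ((a : ℂ) • ρ₁ + (b : ℂ) • ρ₂) := fun x =>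
  add_nonneg (mul_nonneg (Complex.zero_le_real.2 ha) (h₁ x))
    (mul_nonneg (Complex.zero_le_real.2 hb) (h₂ x))

theorem sum_sum_apply_mul_star (ρ : StrongDual ℂ (ToeplitzCuntz ι)) {κ : Type*} (s : Finset κ)
    (a : κ → ToeplitzCuntz ι) :
    ∑ i ∈ s, ∑ j ∈ s, ρ (a j * star (a i)) = ρ ((∑ i ∈ s, a i) * star (∑ i ∈ s, a i)) := by
  rw [star_sum, Finset.sum_mul_sum, map_sum, Finset.sum_comm]
  exact Finset.sum_congr rfl fun i _ => (map_sum ρ _ _).symm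

/-- Words of equal length are isometries with orthogonal ranges, so every finite sum is bounded by
ρ(1). -/
theorem summable_apply_word_mul_star {ρ : StrongDual ℂ (ToeplitzCuntz ι)}
    (hρ : IsPositiveFunctional ρ) (l : ℕ) : Summable fun μ : List ι =>
    if μ.length = l then (ρ (word μ * star (word μ))).re else 0 := by
  have hnn : ∀ μ : List ι, 0 ≤ (ρ (word μ * star (word μ))).re := fun μ =>
    (Complex.le_def.1 (hρ.apply_mul_star_nonneg _)).1
  refine summable_of_sum_le (c := (ρ 1).re) (fun μ => ?_) fun s => ?_
  · dsimp only
    split_ifs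
    exacts [hnn μ, le_rfl]
  · rw [← Finset.sum_filter]
    have h := IsPositiveFunctional.sum_mul_star_le (ρ := ρ.toLinearMap) hρ
      (w := fun μ : List ι => word μ) (s := s.filter fun μ => μ.length = l)
      (fun μ _ => star_word_mul_word_self μ) (fun μ hμ ν hν hne => star_word_mul_word_of_ne
        ((Finset.mem_filter.1 hμ).2.trans (Finset.mem_filter.1 hν).2.symm) hne) 1
    have h2 := (Complex.le_def.1 h).1
    simp only [one_mul, star_one, Complex.sub_re, Complex.re_sum, Complex.zero_re] at h2
    exact sub_nonneg.1 h2

variable [Countable ι]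

theorem exists_inner_eq_apply_mul_star (ρ : StrongDual ℂ (ToeplitzCuntz ι)) (i j : ℕ) :
    ∃ A : WordSpace ι j →L[ℂ] WordSpace ι i, ∀ (x : WordSpace ι j) (y : WordSpace ι i),
      inner ℂ y (A x) = ρ ((x : ToeplitzCuntz ι) * star (y : ToeplitzCuntz ι)) := by
  let B : WordSpace ι i →ₗ⋆[ℂ] WordSpace ι j →ₗ[ℂ] ℂ :=
    LinearMap.mk₂'ₛₗ (starRingEnd ℂ) (RingHom.id ℂ)
      (fun y x => ρ ((x : ToeplitzCuntz ι) * star (y : ToeplitzCuntz ι)))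
      (fun y y' x => by simp [mul_add]) (fun c y x => by simp)
      (fun y x x' => by simp [add_mul]) (fun c y x => by simp)
  have hB : ∀ y x, ‖B y x‖ ≤ ‖ρ‖ * ‖y‖ * ‖x‖ := fun y x => by
    refine (ρ.le_opNorm _).trans ?_
    rw [mul_assoc]
    gcongr
    refine (norm_mul_le _ _).trans ?_
    rw [norm_star, mul_comm]
    rfl
  let B' : WordSpace ι i →L⋆[ℂ] StrongDual ℂ (WordSpace ι j) := B.mkContinuous₂ ‖ρ‖ hB
  -- Riesz representation is conjugate-linear, as is `B'`, so the composite is linear. It represents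
  -- the form in y; the operator sought is its adjoint.
  let A : WordSpace ι i →L[ℂ] WordSpace ι j :=
    ((InnerProductSpace.toDual ℂ (WordSpace ι j)).symm.toContinuousLinearEquiv :
      StrongDual ℂ (WordSpace ι j) →L⋆[ℂ] WordSpace ι j).comp B'
  refine ⟨A.adjoint, fun x y => ?_⟩
  rw [ContinuousLinearMap.adjoint_inner_right]
  exact InnerProductSpace.toDual_symm_apply

/-- The operator matrix with `⟨Ω x, y⟩ = ρ(x y*)` for all homogeneous `x`, `y`. -/
noncomputable def densityMatrix (ρ : StrongDual ℂ (ToeplitzCuntz ι)) : OperatorMatrix ι :=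
  fun i j => (exists_inner_eq_apply_mul_star ρ i j).choose

variable {ρ : StrongDual ℂ (ToeplitzCuntz ι)}

theorem inner_densityMatrix {i j : ℕ} (x : WordSpace ι j) (y : WordSpace ι i) :
    inner ℂ y (densityMatrix ρ i j x) = ρ ((x : ToeplitzCuntz ι) * star (y : ToeplitzCuntz ι)) :=
  (exists_inner_eq_apply_mul_star ρ i j).choose_spec x y

theorem hasDensityMatrix_densityMatrix : HasDensityMatrix ρ (densityMatrix ρ) :=
  fun μ ν => (inner_densityMatrix (wordVec μ) (wordVec ν)).symm

theorem kernel_densityMatrix (μ ν : List ι) :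
    (densityMatrix ρ).kernel μ ν = ρ (word μ * star (word ν)) :=
  inner_densityMatrix _ _

theorem isPositive_densityMatrix (hρ : IsPositiveFunctional ρ) : (densityMatrix ρ).IsPositive := by
  rw [OperatorMatrix.isPositive_iff_inner]
  intro k f
  rw [OperatorMatrix.inner_truncation]
  simp only [inner_densityMatrix]
  rw [sum_sum_apply_mul_star ρ _ fun i => (f i : ToeplitzCuntz ι)]
  exact hρ.apply_mul_star_nonneg _

theorem isLocallyTraceClass_densityMatrix (hρ : IsPositiveFunctional ρ) :
    (densityMatrix ρ).IsLocallyTraceClass := by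
  rw [OperatorMatrix.isLocallyTraceClass_iff (isPositive_densityMatrix hρ)]
  intro k
  refine (summable_sum (s := Finset.range (k + 1)) fun l _ =>
    summable_apply_word_mul_star hρ l).congr fun μ => ?_
  rw [Finset.sum_ite_eq, kernel_densityMatrix]
  simp only [Finset.mem_range, Nat.lt_succ_iff]

theorem densityMatrix_mem (hρ : IsPositiveFunctional ρ) :
    densityMatrix ρ ∈ sliceDecreasingCone ι := by
  have hp := isPositive_densityMatrix hρ
  have ht := isLocallyTraceClass_densityMatrix hρ
  refine ⟨hp, ht, ?_⟩
  rw [OperatorMatrix.isPositive_iff_inner]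
  intro k f
  rw [OperatorMatrix.inner_truncation]
  set g : ToeplitzCuntz ι := ∑ i ∈ Finset.range (k + 1), (f i : ToeplitzCuntz ι) with hg
  have h1 : ∑ i ∈ Finset.range (k + 1), ∑ j ∈ Finset.range (k + 1),
      inner ℂ (f i) (densityMatrix ρ i j (f j)) = ρ (g * star g) := by
    simp only [inner_densityMatrix]
    exact sum_sum_apply_mul_star ρ _ fun i => (f i : ToeplitzCuntz ι)
  -- On the vector f the form of Ω is ρ(g g*), where g is the sum of the components up to k; slicing
  -- replaces g by g v_m and sums over m.
  have h2 : HasSum (fun m => ρ (g * gen m * star (g * gen m)))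
      (∑ i ∈ Finset.range (k + 1), ∑ j ∈ Finset.range (k + 1),
        inner ℂ (f i) ((densityMatrix ρ).slice i j (f j))) := by
    refine (hasSum_sum fun i _ => hasSum_sum fun j _ =>
      OperatorMatrix.hasSum_inner_slice hp ht (f j) (f i)).congr_fun fun m => ?_
    simp only [inner_densityMatrix, rightCreation_apply]
    rw [sum_sum_apply_mul_star ρ _ fun i => (f i : ToeplitzCuntz ι) * gen m, ← Finset.sum_mul]
  have h3 : ∑ i ∈ Finset.range (k + 1), ∑ j ∈ Finset.range (k + 1),
      inner ℂ (f i) ((densityMatrix ρ - (densityMatrix ρ).slice) i j (f j)) =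
      ρ (g * star g) - ∑ i ∈ Finset.range (k + 1), ∑ j ∈ Finset.range (k + 1),
        inner ℂ (f i) ((densityMatrix ρ).slice i j (f j)) := by
    rw [← h1]
    simp only [← Finset.sum_sub_distrib, ← inner_sub_right]
    rfl
  rw [h3]
  have := Complex.orderClosedTopology
  have h4 : Tendsto (fun s : Finset ι =>
      ρ (g * star g) - ∑ m ∈ s, ρ (g * gen m * star (g * gen m))) atTop (𝓝 _) :=
    tendsto_const_nhds.sub h2
  -- For infinitely many generators the Bessel inequality holds for finite subsets and passes to the
  -- limit.
  exact ge_of_tendsto' h4 fun s => IsPositiveFunctional.sum_mul_star_le (ρ := ρ.toLinearMap) hρ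
    (fun i _ => isToeplitzFamily_gen.1 i) (fun i _ j _ hij => isToeplitzFamily_gen.2 i j hij) g

/-! ### The correspondence between operator matrices and functionals -/

theorem HasDensityMatrix.unique {Ω₁ Ω₂ : OperatorMatrix ι} {σ : ToeplitzCuntz ι → ℂ}
    (h₁ : HasDensityMatrix σ Ω₁) (h₂ : HasDensityMatrix σ Ω₂) : Ω₁ = Ω₂ :=
  OperatorMatrix.ext_kernel (funext fun μ => funext fun ν => (h₁ μ ν).symm.trans (h₂ μ ν))

/-- Ω must be `densityMatrix ρ`. Membership of sums and differences in the cone is thereby reduced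
to positivity of the corresponding functionals. -/
theorem HasDensityMatrix.mem {Ω : OperatorMatrix ι} (h : HasDensityMatrix ρ Ω)
    (hρ : ρ ∈ positiveDual ι) : Ω ∈ sliceDecreasingCone ι :=
  h.unique hasDensityMatrix_densityMatrix ▸ densityMatrix_mem hρ

theorem HasDensityMatrix.functional_unique {Ω : OperatorMatrix ι}
    {ρ₁ ρ₂ : StrongDual ℂ (ToeplitzCuntz ι)} (h₁ : HasDensityMatrix ρ₁ Ω)
    (h₂ : HasDensityMatrix ρ₂ Ω) : ρ₁ = ρ₂ :=
  strongDual_ext fun μ ν => (h₁ μ ν).trans (h₂ μ ν).symm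

theorem HasDensityMatrix.lin_comb {Ω₁ Ω₂ : OperatorMatrix ι}
    {ρ₁ ρ₂ : StrongDual ℂ (ToeplitzCuntz ι)} (h₁ : HasDensityMatrix ρ₁ Ω₁)
    (h₂ : HasDensityMatrix ρ₂ Ω₂) (a b : ℂ) :
    HasDensityMatrix (a • ρ₁ + b • ρ₂) (a • Ω₁ + b • Ω₂) := by
  intro μ ν
  rw [add_apply, smul_apply, smul_apply, h₁, h₂]
  simp [inner_add_right, inner_smul_right]

theorem HasDensityMatrix.sub {Ω₁ Ω₂ : OperatorMatrix ι}
    {ρ₁ ρ₂ : StrongDual ℂ (ToeplitzCuntz ι)} (h₁ : HasDensityMatrix ρ₁ Ω₁)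
    (h₂ : HasDensityMatrix ρ₂ Ω₂) : HasDensityMatrix (ρ₁ - ρ₂) (Ω₁ - Ω₂) := by
  intro μ ν
  rw [sub_apply, h₁, h₂]
  simp [inner_sub_right]

theorem exists_mem_positiveDual {Ω : OperatorMatrix ι} (h : Ω ∈ sliceDecreasingCone ι) :
    ∃ ρ ∈ positiveDual ι, HasDensityMatrix ρ Ω := by
  obtain ⟨ρ, hρ, hρΩ⟩ := exists_hasDensityMatrix h
  exact ⟨⟨ρ, hρ.continuous⟩, hρ, hρΩ⟩

variable (ι) in
/-- The bijection between the cone of operator matrices and the positive functionals. -/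
noncomputable def functionalEquiv : sliceDecreasingCone ι ≃ positiveDual ι where
  toFun Ω := ⟨(exists_mem_positiveDual Ω.2).choose, (exists_mem_positiveDual Ω.2).choose_spec.1⟩
  invFun ρ := ⟨densityMatrix ρ.1, densityMatrix_mem ρ.2⟩
  left_inv Ω := Subtype.ext <|
    hasDensityMatrix_densityMatrix.unique (exists_mem_positiveDual Ω.2).choose_spec.2
  right_inv ρ := Subtype.ext <|
    HasDensityMatrix.functional_unique
      (exists_mem_positiveDual (densityMatrix_mem ρ.2)).choose_spec.2
      hasDensityMatrix_densityMatrix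

theorem hasDensityMatrix_functionalEquiv (Ω : sliceDecreasingCone ι) :
    HasDensityMatrix (functionalEquiv ι Ω).1 Ω.1 :=
  (exists_mem_positiveDual Ω.2).choose_spec.2

end ToeplitzCuntz

open ToeplitzCuntz in
theorem mainTheorem2 (n : ℕ∞) (hn : 1 ≤ n) :
    (∀ Ω ∈ ToeplitzCuntz.sliceDecreasingCone (ToeplitzCuntz.Letters n),
      ∃! ρ : ToeplitzCuntz (ToeplitzCuntz.Letters n) →ₗ[ℂ] ℂ,
        ToeplitzCuntz.IsPositiveFunctional ρ ∧ ToeplitzCuntz.HasDensityMatrix ρ Ω) ∧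
    ∃ Φ : ToeplitzCuntz.sliceDecreasingCone (ToeplitzCuntz.Letters n) ≃
        ToeplitzCuntz.positiveDual (ToeplitzCuntz.Letters n),
      (∀ Ω, ToeplitzCuntz.HasDensityMatrix (Φ Ω).1 Ω.1) ∧
      (∀ (Ω₁ Ω₂ : ToeplitzCuntz.sliceDecreasingCone (ToeplitzCuntz.Letters n)) (a b : ℝ),
        0 ≤ a → 0 ≤ b →
        ∃ h : (a : ℂ) • Ω₁.1 + (b : ℂ) • Ω₂.1 ∈
            ToeplitzCuntz.sliceDecreasingCone (ToeplitzCuntz.Letters n),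
          (Φ ⟨(a : ℂ) • Ω₁.1 + (b : ℂ) • Ω₂.1, h⟩).1 = (a : ℂ) • (Φ Ω₁).1 + (b : ℂ) • (Φ Ω₂).1) ∧
      (∀ Ω₁ Ω₂ : ToeplitzCuntz.sliceDecreasingCone (ToeplitzCuntz.Letters n),
        Ω₂.1 - Ω₁.1 ∈ ToeplitzCuntz.sliceDecreasingCone (ToeplitzCuntz.Letters n) ↔
          (Φ Ω₂).1 - (Φ Ω₁).1 ∈ ToeplitzCuntz.positiveDual (ToeplitzCuntz.Letters n)) := by
  refine ⟨fun Ω hΩ => ?_, functionalEquiv _, hasDensityMatrix_functionalEquiv,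
    fun Ω₁ Ω₂ a b ha hb => ?_, fun Ω₁ Ω₂ => ?_⟩
  · obtain ⟨ρ, hρ, hρΩ⟩ := exists_hasDensityMatrix hΩ
    refine ⟨ρ, ⟨hρ, hρΩ⟩, fun σ ⟨hσ, hσΩ⟩ => ?_⟩
    -- Automatic continuity places the competitor σ in the dual, where the values on `v_μ v_ν*`
    -- determine it.
    have h : (⟨σ, hσ.continuous⟩ : StrongDual ℂ _) = ⟨ρ, hρ.continuous⟩ :=
      HasDensityMatrix.functional_unique hσΩ hρΩ
    exact congrArg ContinuousLinearMap.toLinearMap h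
  · have hd := (hasDensityMatrix_functionalEquiv Ω₁).lin_comb
      (hasDensityMatrix_functionalEquiv Ω₂) a b
    have hm := hd.mem
      (IsPositiveFunctional.lin_comb (functionalEquiv _ Ω₁).2 (functionalEquiv _ Ω₂).2 ha hb)
    exact ⟨hm, (hasDensityMatrix_functionalEquiv ⟨_, hm⟩).functional_unique hd⟩
  · have hd := (hasDensityMatrix_functionalEquiv Ω₂).sub (hasDensityMatrix_functionalEquiv Ω₁)
    refine ⟨fun h => ?_, hd.mem⟩
    rw [← (hasDensityMatrix_functionalEquiv ⟨_, h⟩).functional_unique hd]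
    exact (functionalEquiv _ ⟨_, h⟩).2
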